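/- The following is a theorem of Bishop-style constructive mathematics (BISH), here formalised as intuitionistic first-order logic with equality over constructive Zermelo–Fraenkel set theory (CZF: extensionality, pairing, union, infinity, set induction, separation for bounded formulas, strong collection, subset collection) together with the axiom of dependent choice; that is, the sentence below is derivable from these axioms in intuitionistic logic (no use of the law of excluded middle). Let $(X,\rho)$ be a compact (that is, complete and totally bounded) metric space with the positivity property: for each uniformly continuous $g:X\to\mathbf R$ with $g(x)>0$ for all $x\in X$, the infimum $\inf_X g$ exists and is positive. Let $Y$ be a normed space, and let $f:X\to Y$ be uniformly continuous with zero set $Z_f=\{x\in X: f(x)=0\}$. Suppose that $Z_f$ is inhabited (it has an element) and located in $X$ (for each $x\in X$ the distance $\inf\{\rho(x,z): z\in Z_f\}$ exists), and that $f$ is Z-stable: for each $x\in X$ and each $\varepsilon>0$ there exists $\delta>0$ such that if $\|f(x)\|<\delta$, then there is $z\in Z_f$ with $\rho(x,z)<\varepsilon$. Then $f$ is uniformly Z-stable on $X$: for each $\varepsilon>0$ there exists $\delta>0$ such that for each $x\in X$, if $\|f(x)\|<\delta$, then there is $z\in Z_f$ with $\rho(x,z)<\varepsilon$. Here $\mathbf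 R$ is the complete Archimedean ordered field (unique up to isomorphism; completeness is the constructive least-upper-bound principle), normed spaces are over $\mathbf R$, $a\le b$ means that $b<a$ is false, and "$m$ is the infimum of $S\subset\mathbf R$" means that $m\le s$ for all $s\in S$ and that for each $\varepsilon>0$ there is $s\in S$ with $s<m+\varepsilon$. -/

import Mathlib

/-! BISH as intuitionistic first-order logic over constructive Zermelo–Fraenkel set theory (CZF)
with dependent choice, and elementary constructive analysis written in its language. -/

namespace BISH

/-! ### Formulas of set theory and intuitionistic provability -/

/-- First-order formulas in the language `∈, =`. Variables are de Bruijn indices. -/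
inductive Fm : Type
  | mem (i j : ℕ) : Fm
  | eq (i j : ℕ) : Fm
  | bot : Fm
  | and (φ ψ : Fm) : Fm
  | or (φ ψ : Fm) : Fm
  | imp (φ ψ : Fm) : Fm
  | all (φ : Fm) : Fm
  | ex (φ : Fm) : Fm

/-- Extend a renaming of variables under a binder. -/
def lift (r : ℕ → ℕ) : ℕ → ℕ
  | 0 => 0
  | n + 1 => r n + 1

/-- (Capture-avoiding) renaming of the free variables of a formula. -/
def Fm.rename : (ℕ → ℕ) → Fm → Fm
  | r, .mem i j => .mem (r i) (r j)
  | r, .eq i j => .eq (r i) (r j)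
  | _, .bot => .bot
  | r, .and φ ψ => .and (φ.rename r) (ψ.rename r)
  | r, .or φ ψ => .or (φ.rename r) (ψ.rename r)
  | r, .imp φ ψ => .imp (φ.rename r) (ψ.rename r)
  | r, .all φ => .all (φ.rename (lift r))
  | r, .ex φ => .ex (φ.rename (lift r))

/-- Weakening: the formula seen from below one more binder. -/
def Fm.shift (φ : Fm) : Fm := φ.rename Nat.succ

/-- Substitution of the variable `k` for the variable `0` of the body of a quantifier. -/
def Fm.inst (φ : Fm) (k : ℕ) : Fm :=
  φ.rename fun n => match n with
    | 0 => k
    | m + 1 => m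

/-- Natural deduction for intuitionistic first-order logic with equality:
`Prf T Γ φ` says that `φ` is derivable from the hypotheses `Γ` and the axioms `T`
(an axiom with free variables stands for its universal closure). -/
inductive Prf (T : Set Fm) : List Fm → Fm → Prop
  | ax {Γ : List Fm} {φ : Fm} : φ ∈ T → Prf T Γ φ
  | hyp {Γ : List Fm} {φ : Fm} : φ ∈ Γ → Prf T Γ φ
  | botE {Γ : List Fm} {φ : Fm} : Prf T Γ .bot → Prf T Γ φ
  | andI {Γ : List Fm} {φ ψ : Fm} : Prf T Γ φ → Prf T Γ ψ → Prf T Γ (.and φ ψ)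
  | andE₁ {Γ : List Fm} {φ ψ : Fm} : Prf T Γ (.and φ ψ) → Prf T Γ φ
  | andE₂ {Γ : List Fm} {φ ψ : Fm} : Prf T Γ (.and φ ψ) → Prf T Γ ψ
  | orI₁ {Γ : List Fm} {φ ψ : Fm} : Prf T Γ φ → Prf T Γ (.or φ ψ)
  | orI₂ {Γ : List Fm} {φ ψ : Fm} : Prf T Γ ψ → Prf T Γ (.or φ ψ)
  | orE {Γ : List Fm} {φ ψ χ : Fm} :
      Prf T Γ (.or φ ψ) → Prf T (φ :: Γ) χ → Prf T (ψ :: Γ) χ → Prf T Γ χ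
  | impI {Γ : List Fm} {φ ψ : Fm} : Prf T (φ :: Γ) ψ → Prf T Γ (.imp φ ψ)
  | impE {Γ : List Fm} {φ ψ : Fm} : Prf T Γ (.imp φ ψ) → Prf T Γ φ → Prf T Γ ψ
  | allI {Γ : List Fm} {φ : Fm} : Prf T (Γ.map Fm.shift) φ → Prf T Γ (.all φ)
  | allE {Γ : List Fm} {φ : Fm} (k : ℕ) : Prf T Γ (.all φ) → Prf T Γ (φ.inst k)
  | exI {Γ : List Fm} {φ : Fm} (k : ℕ) : Prf T Γ (φ.inst k) → Prf T Γ (.ex φ)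
  | exE {Γ : List Fm} {φ ψ : Fm} :
      Prf T Γ (.ex φ) → Prf T (φ :: Γ.map Fm.shift) ψ.shift → Prf T Γ ψ
  | eqI {Γ : List Fm} (i : ℕ) : Prf T Γ (.eq i i)
  | eqE {Γ : List Fm} {φ : Fm} {i j : ℕ} :
      Prf T Γ (.eq i j) → Prf T Γ (φ.inst i) → Prf T Γ (φ.inst j)

/-! ### Writing formulas with named bound variables

A term of type `F` is a formula that may be placed below any number `d` of binders. Bound
variables are named by their level: the variable bound by the outermost quantifier is `0`, the one
bound by the next quantifier is `1`, and so on. Thus `all fun x => φ` supplies the name `x` of the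
variable that it binds. -/

/-- Formulas as functions of the number of binders around them. -/
abbrev F : Type := ℕ → Fm

def mem (x y : ℕ) : F := fun d => .mem (d - 1 - x) (d - 1 - y)
def eq (x y : ℕ) : F := fun d => .eq (d - 1 - x) (d - 1 - y)
def bot : F := fun _ => .bot
def and (φ ψ : F) : F := fun d => .and (φ d) (ψ d)
def or (φ ψ : F) : F := fun d => .or (φ d) (ψ d)
def imp (φ ψ : F) : F := fun d => .imp (φ d) (ψ d)
def all (φ : ℕ → F) : F := fun d => .all (φ d (d + 1))
def ex (φ : ℕ → F) : F := fun d => .ex (φ d (d + 1))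

/-- The formula `φ` with its first free variables replaced by `vs`; its other free variables are
parameters, free in the whole formula. -/
def sub (φ : Fm) (vs : List ℕ) : F := fun d =>
  φ.rename fun i => if i < vs.length then d - 1 - vs.getD i 0 else i - vs.length + d

/-- The formula, not below any binder. -/
def close (φ : F) : Fm := φ 0

infix:50 " ∊ " => mem
infix:50 " ≐ " => eq
infixr:35 " ⋏ " => and
infixr:30 " ⋎ " => or
infixr:25 " ⟹ " => imp

def not (φ : F) : F := φ ⟹ bot
def iff (φ ψ : F) : F := (φ ⟹ ψ) ⋏ (ψ ⟹ φ)
def allIn (a : ℕ) (φ : ℕ → F) : F := all fun x => x ∊ a ⟹ φ x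
def exIn (a : ℕ) (φ : ℕ → F) : F := ex fun x => x ∊ a ⋏ φ x

/-! ### Basic set-theoretic notions -/

def isEmpty (z : ℕ) : F := all fun x => not (x ∊ z)

/-- `y = x ∪ {x}` -/
def isSucc (y x : ℕ) : F := all fun z => iff (z ∊ y) (z ∊ x ⋎ z ≐ x)

/-- `w = ω`, the set of natural numbers `n = {0, …, n - 1}` (by set induction there is at most one
such `w`). -/
def isOmega (w : ℕ) : F := all fun x => iff (x ∊ w) (isEmpty x ⋎ exIn w fun y => isSucc x y)

/-- `z = {x, y}` -/
def isUPair (z x y : ℕ) : F := all fun w => iff (w ∊ z) (w ≐ x ⋎ w ≐ y)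

/-- `p = (x, y)`, that is `p = {{x}, {x, y}}` -/
def isPair (p x y : ℕ) : F := all fun z => iff (z ∊ p) (isUPair z x x ⋎ isUPair z x y)

/-- `(x, y) ∈ r`; when `r` is a function, `r(x) = y`. -/
def rel (r x y : ℕ) : F := ex fun p => isPair p x y ⋏ p ∊ r

def isSubset (a b : ℕ) : F := allIn a fun x => x ∊ b

/-- `c = a × b` -/
def isProd (c a b : ℕ) : F := all fun p => iff (p ∊ c) (exIn a fun x => exIn b fun y => isPair p x y)

/-- `f` is a function from `a` to `b`. -/
def isFun (f a b : ℕ) : F :=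
  (allIn f fun p => exIn a fun x => exIn b fun y => isPair p x y) ⋏
  (allIn a fun x => exIn b fun y => rel f x y) ⋏
  (all fun x => all fun y => all fun y' => rel f x y ⟹ rel f x y' ⟹ y ≐ y')

/-- `f` is a function from `a × b` to `c`. -/
def isFun₂ (f a b c : ℕ) : F := ex fun q => isProd q a b ⋏ isFun f q c

/-- `φ(f(x))` -/
def ap (f x : ℕ) (φ : ℕ → F) : F := ex fun y => rel f x y ⋏ φ y

/-- `φ(f(x, y))` -/
def ap₂ (f x y : ℕ) (φ : ℕ → F) : F := ex fun p => isPair p x y ⋏ ap f p φ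

/-! ### The axioms of CZF, and dependent choice -/

/-- Bounded (`Δ₀`) formulas. -/
inductive IsBounded : Fm → Prop
  | mem (i j : ℕ) : IsBounded (.mem i j)
  | eq (i j : ℕ) : IsBounded (.eq i j)
  | bot : IsBounded .bot
  | and {φ ψ : Fm} : IsBounded φ → IsBounded ψ → IsBounded (.and φ ψ)
  | or {φ ψ : Fm} : IsBounded φ → IsBounded ψ → IsBounded (.or φ ψ)
  | imp {φ ψ : Fm} : IsBounded φ → IsBounded ψ → IsBounded (.imp φ ψ)
  | all (k : ℕ) {φ : Fm} : IsBounded φ → IsBounded (.all (.imp (.mem 0 (k + 1)) φ))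
  | ex (k : ℕ) {φ : Fm} : IsBounded φ → IsBounded (.ex (.and (.mem 0 (k + 1)) φ))

def extensionality : F :=
  all fun a => all fun b => (all fun x => iff (x ∊ a) (x ∊ b)) ⟹ a ≐ b

def pairing : F := all fun a => all fun b => ex fun c => isUPair c a b

def union : F := all fun a => ex fun c => all fun x => iff (x ∊ c) (exIn a fun y => x ∊ y)

def infinity : F := ex fun w => isOmega w

def setInduction (φ : Fm) : F :=
  (all fun a => (allIn a fun x => sub φ [x]) ⟹ sub φ [a]) ⟹ all fun a => sub φ [a]

/-- Separation; an axiom for bounded `φ` only. -/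
def separation (φ : Fm) : F :=
  all fun a => ex fun b => all fun x => iff (x ∊ b) (x ∊ a ⋏ sub φ [x])

/-- Every element of `a` is `φ`-related to an element of `b`, and conversely (the further
free variables of `φ` being `vs`). -/
def totalBetween (φ : Fm) (a b : ℕ) (vs : List ℕ) : F :=
  (allIn a fun x => exIn b fun y => sub φ (x :: y :: vs)) ⋏
  (allIn b fun y => exIn a fun x => sub φ (x :: y :: vs))

def strongCollection (φ : Fm) : F :=
  all fun a => (allIn a fun x => ex fun y => sub φ [x, y]) ⟹ ex fun b => totalBetween φ a b []

def subsetCollection (φ : Fm) : F :=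
  all fun a => all fun b => ex fun c => all fun u =>
    (allIn a fun x => exIn b fun y => sub φ [x, y, u]) ⟹
      exIn c fun d => totalBetween φ a d [u]

/-- Dependent choice. -/
def dependentChoice : F :=
  all fun w => isOmega w ⟹ all fun a => all fun r =>
    (allIn a fun x => exIn a fun y => rel r x y) ⟹
    allIn a fun b => ex fun s => isFun s w a ⋏
      (allIn w fun n => isEmpty n ⟹ rel s n b) ⋏
      (allIn w fun n => allIn w fun m => isSucc m n ⟹ ap s n fun x => ap s m fun y => rel r x y)

/-- Constructive Zermelo–Fraenkel set theory. -/
inductive CZF : Set Fm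
  | extensionality : CZF (close extensionality)
  | pairing : CZF (close pairing)
  | union : CZF (close union)
  | infinity : CZF (close infinity)
  | setInduction (φ : Fm) : CZF (close (setInduction φ))
  | separation (φ : Fm) : IsBounded φ → CZF (close (separation φ))
  | strongCollection (φ : Fm) : CZF (close (strongCollection φ))
  | subsetCollection (φ : Fm) : CZF (close (subsetCollection φ))

/-- The axioms of Bishop-style constructive mathematics: CZF with dependent choice. -/
def axioms : Set Fm := CZF ∪ {close dependentChoice}

/-- `BISH ⊢ φ`, for a sentence `φ`. -/
def Provable (φ : F) : Prop := Prf axioms [] (close φ)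

/-! ### Real numbers -/

/-- (Names of) a set `car` with binary operations `plus`, `times`, a relation `less`, and elements
`zero`, `one`. -/
structure RealVars where
  (car plus times less zero one : ℕ)

namespace RealVars

def lt (R : RealVars) (x y : ℕ) : F := rel R.less x y

/-- `x ≤ y` means that `y < x` is false. -/
def le (R : RealVars) (x y : ℕ) : F := not (R.lt y x)

def pos (R : RealVars) (x : ℕ) : F := R.lt R.zero x

/-- For all positive `e` -/
def allPos (R : RealVars) (φ : ℕ → F) : F := allIn R.car fun e => R.pos e ⟹ φ e

/-- For some positive `e` -/
def exPos (R : RealVars) (φ : ℕ → F) : F := exIn R.car fun e => R.pos e ⋏ φ e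

/-- Commutative ring in which each positive element has a positive inverse (so that, taking
negatives, each negative element has a negative inverse). -/
def isField (R : RealVars) : F :=
  R.zero ∊ R.car ⋏ R.one ∊ R.car ⋏
  isFun₂ R.plus R.car R.car R.car ⋏ isFun₂ R.times R.car R.car R.car ⋏
  (allIn R.car fun x => allIn R.car fun y => allIn R.car fun z =>
    ap₂ R.plus x y fun u => ap₂ R.plus u z fun s =>
      ap₂ R.plus y z fun v => ap₂ R.plus x v fun t => s ≐ t) ⋏
  (allIn R.car fun x => allIn R.car fun y =>
    ap₂ R.plus x y fun s => ap₂ R.plus y x fun t => s ≐ t) ⋏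
  (allIn R.car fun x => ap₂ R.plus x R.zero fun s => s ≐ x) ⋏
  (allIn R.car fun x => exIn R.car fun y => ap₂ R.plus x y fun s => s ≐ R.zero) ⋏
  (allIn R.car fun x => allIn R.car fun y => allIn R.car fun z =>
    ap₂ R.times x y fun u => ap₂ R.times u z fun s =>
      ap₂ R.times y z fun v => ap₂ R.times x v fun t => s ≐ t) ⋏
  (allIn R.car fun x => allIn R.car fun y =>
    ap₂ R.times x y fun s => ap₂ R.times y x fun t => s ≐ t) ⋏
  (allIn R.car fun x => ap₂ R.times x R.one fun s => s ≐ x) ⋏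
  (allIn R.car fun x => allIn R.car fun y => allIn R.car fun z =>
    ap₂ R.plus y z fun u => ap₂ R.times x u fun s =>
      ap₂ R.times x y fun v => ap₂ R.times x z fun w => ap₂ R.plus v w fun t => s ≐ t) ⋏
  (R.allPos fun x => R.exPos fun y => ap₂ R.times x y fun s => s ≐ R.one)

/-- `<` is an asymmetric, cotransitive, tight relation compatible with the operations. -/
def isOrdered (R : RealVars) : F :=
  R.lt R.zero R.one ⋏
  (allIn R.car fun x => allIn R.car fun y => not (R.lt x y ⋏ R.lt y x)) ⋏
  (allIn R.car fun x => allIn R.car fun y => R.lt x y ⟹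
    allIn R.car fun z => R.lt x z ⋎ R.lt z y) ⋏
  (allIn R.car fun x => allIn R.car fun y => R.le x y ⟹ R.le y x ⟹ x ≐ y) ⋏
  (allIn R.car fun x => allIn R.car fun y => R.lt x y ⟹
    allIn R.car fun z => ap₂ R.plus x z fun s => ap₂ R.plus y z fun t => R.lt s t) ⋏
  (R.allPos fun x => R.allPos fun y => ap₂ R.times x y fun s => R.pos s)

/-- For each `x` there is a natural number `n` with `x < n • 1`; here `nu` is the function
`n ↦ n • 1`, defined by recursion on `ω = w`. -/
def isArchimedean (R : RealVars) (w : ℕ) : F :=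
  ex fun nu => isFun nu w R.car ⋏
    (allIn w fun n => isEmpty n ⟹ rel nu n R.zero) ⋏
    (allIn w fun n => allIn w fun m => isSucc m n ⟹
      ap nu n fun x => ap₂ R.plus x R.one fun y => rel nu m y) ⋏
    (allIn R.car fun x => exIn w fun n => ap nu n fun y => R.lt x y)

/-- The constructive least-upper-bound principle: an inhabited set `S`, bounded above, such that
for all `a < b` either `b` is an upper bound of `S` or some member of `S` exceeds `a`,
has a supremum. -/
def isComplete (R : RealVars) : F :=
  all fun S => isSubset S R.car ⟹ (ex fun s => s ∊ S) ⟹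
    (exIn R.car fun b => allIn S fun s => R.le s b) ⟹
    (allIn R.car fun a => allIn R.car fun b => R.lt a b ⟹
      (allIn S fun s => R.le s b) ⋎ (exIn S fun s => R.lt a s)) ⟹
    exIn R.car fun m => (allIn S fun s => R.le s m) ⋏
      (allIn R.car fun a => R.lt a m ⟹ exIn S fun s => R.lt a s)

/-- `R` is the field of real numbers, that is, the complete Archimedean ordered field. These axioms
determine `R` up to a unique isomorphism, and the Dedekind reals satisfy them. -/
def isReals (R : RealVars) (w : ℕ) : F :=
  R.isField ⋏ R.isOrdered ⋏ R.isArchimedean w ⋏ R.isComplete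

/-- `t = |a|`, the least real number `t` with `a ≤ t` and `-a ≤ t` -/
def isAbs (R : RealVars) (a t : ℕ) : F :=
  exIn R.car fun b => (ap₂ R.plus a b fun s => s ≐ R.zero) ⋏ t ∊ R.car ⋏ R.le a t ⋏ R.le b t ⋏
    allIn R.car fun s => R.le a s ⟹ R.le b s ⟹ R.le t s

/-- `m` is the infimum of the real numbers `e` such that `e` is the value at some `x ∈ S`, where
`v x φ` stands for `φ(value at x)`. Constructively: `m` is a lower bound, and for each `ε > 0` there
is a value smaller than `m + ε`. -/
def isInf (R : RealVars) (S m : ℕ) (v : ℕ → (ℕ → F) → F) : F :=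
  m ∊ R.car ⋏ (allIn S fun x => v x fun e => R.le m e) ⋏
  (R.allPos fun ε => exIn S fun x => v x fun e => ap₂ R.plus m ε fun t => R.lt e t)

end RealVars

/-! ### Metric spaces -/

/-- (Names of) a set `car` and a distance function `dist` on it. -/
structure MetricVars where
  (car dist : ℕ)

namespace MetricVars

/-- `φ(ρ(x, y))` -/
def d (X : MetricVars) (x y : ℕ) (φ : ℕ → F) : F := ap₂ X.dist x y φ

def isMetric (X : MetricVars) (R : RealVars) : F :=
  isFun₂ X.dist X.car X.car R.car ⋏
  (allIn X.car fun x => allIn X.car fun y => X.d x y fun a => R.le R.zero a) ⋏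
  (allIn X.car fun x => allIn X.car fun y => X.d x y fun a => iff (a ≐ R.zero) (x ≐ y)) ⋏
  (allIn X.car fun x => allIn X.car fun y => X.d x y fun a => X.d y x fun b => a ≐ b) ⋏
  (allIn X.car fun x => allIn X.car fun y => allIn X.car fun z =>
    X.d x z fun a => X.d x y fun b => X.d y z fun c => ap₂ R.plus b c fun s => R.le a s)

/-- For each `ε > 0` there are `n ∈ ω` and points `t(0), …, t(n - 1)` such that each point of `X` is
within `ε` of one of them. -/
def isTotallyBounded (X : MetricVars) (R : RealVars) (w : ℕ) : F :=
  R.allPos fun ε => exIn w fun n => ex fun t => isFun t n X.car ⋏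
    allIn X.car fun x => exIn n fun i => ap t i fun y => X.d x y fun a => R.lt a ε

/-- Each Cauchy sequence converges. -/
def isComplete (X : MetricVars) (R : RealVars) (w : ℕ) : F :=
  all fun s => isFun s w X.car ⟹
    (R.allPos fun ε => exIn w fun N => allIn w fun m => allIn w fun n => N ∊ m ⟹ N ∊ n ⟹
      ap s m fun x => ap s n fun y => X.d x y fun a => R.lt a ε) ⟹
    exIn X.car fun x => R.allPos fun ε => exIn w fun N => allIn w fun n => N ∊ n ⟹
      ap s n fun y => X.d x y fun a => R.lt a ε

/-- Compact, in the constructive sense: complete and totally bounded. -/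
def isCompact (X : MetricVars) (R : RealVars) (w : ℕ) : F :=
  X.isComplete R w ⋏ X.isTotallyBounded R w

/-- `ρ(x, S) < ε`: some `y ∈ S` has `ρ(x, y) < ε`. -/
def near (X : MetricVars) (R : RealVars) (x S ε : ℕ) : F :=
  exIn S fun y => X.d x y fun a => R.lt a ε

/-- The subset `S` is located in `X`: the distance `ρ(x, S) = inf {ρ(x, y) : y ∈ S}` exists for each
`x ∈ X`. -/
def isLocated (X : MetricVars) (R : RealVars) (S : ℕ) : F :=
  allIn X.car fun x => ex fun m => R.isInf S m fun y => X.d x y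

/-- The function `g : X → R` is uniformly continuous; the distance of `u` and `v` in `R` is
`|u - v|`. -/
def isUniformlyContinuousReal (X : MetricVars) (R : RealVars) (g : ℕ) : F :=
  R.allPos fun ε => R.exPos fun δ => allIn X.car fun x => allIn X.car fun y =>
    (X.d x y fun a => R.lt a δ) ⟹
      ap g x fun u => ap g y fun v => exIn R.car fun c => (ap₂ R.plus v c fun s => s ≐ u) ⋏
        exIn R.car fun t => R.isAbs c t ⋏ R.lt t ε

/-- The positivity property: each uniformly continuous, positive-valued `g : X → R` has an infimum,
and it is positive. -/
def hasPositivity (X : MetricVars) (R : RealVars) : F :=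
  all fun g => isFun g X.car R.car ⟹ X.isUniformlyContinuousReal R g ⟹
    (allIn X.car fun x => ap g x fun u => R.pos u) ⟹
    R.exPos fun m => R.isInf X.car m fun x => ap g x

end MetricVars

/-! ### Normed spaces -/

/-- (Names of) a set `car` with an addition `sum`, a scalar multiplication `smul`, an element `zero`
and a norm. -/
structure NormedVars where
  (car sum smul zero norm : ℕ)

namespace NormedVars

/-- Normed linear space over `R`. -/
def isNormed (Y : NormedVars) (R : RealVars) : F :=
  Y.zero ∊ Y.car ⋏ isFun₂ Y.sum Y.car Y.car Y.car ⋏ isFun₂ Y.smul R.car Y.car Y.car ⋏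
  isFun Y.norm Y.car R.car ⋏
  (allIn Y.car fun x => allIn Y.car fun y => allIn Y.car fun z =>
    ap₂ Y.sum x y fun u => ap₂ Y.sum u z fun s =>
      ap₂ Y.sum y z fun v => ap₂ Y.sum x v fun t => s ≐ t) ⋏
  (allIn Y.car fun x => allIn Y.car fun y =>
    ap₂ Y.sum x y fun s => ap₂ Y.sum y x fun t => s ≐ t) ⋏
  (allIn Y.car fun x => ap₂ Y.sum x Y.zero fun s => s ≐ x) ⋏
  (allIn Y.car fun x => exIn Y.car fun y => ap₂ Y.sum x y fun s => s ≐ Y.zero) ⋏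
  (allIn Y.car fun x => ap₂ Y.smul R.one x fun s => s ≐ x) ⋏
  (allIn R.car fun a => allIn R.car fun b => allIn Y.car fun x =>
    ap₂ R.times a b fun c => ap₂ Y.smul c x fun s =>
      ap₂ Y.smul b x fun y => ap₂ Y.smul a y fun t => s ≐ t) ⋏
  (allIn R.car fun a => allIn R.car fun b => allIn Y.car fun x =>
    ap₂ R.plus a b fun c => ap₂ Y.smul c x fun s =>
      ap₂ Y.smul a x fun y => ap₂ Y.smul b x fun z => ap₂ Y.sum y z fun t => s ≐ t) ⋏
  (allIn R.car fun a => allIn Y.car fun x => allIn Y.car fun y =>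
    ap₂ Y.sum x y fun u => ap₂ Y.smul a u fun s =>
      ap₂ Y.smul a x fun v => ap₂ Y.smul a y fun z => ap₂ Y.sum v z fun t => s ≐ t) ⋏
  (allIn Y.car fun x => ap Y.norm x fun r => R.le R.zero r ⋏ iff (r ≐ R.zero) (x ≐ Y.zero)) ⋏
  (allIn Y.car fun x => allIn Y.car fun y => ap₂ Y.sum x y fun z => ap Y.norm z fun c =>
    ap Y.norm x fun a => ap Y.norm y fun b => ap₂ R.plus a b fun s => R.le c s) ⋏
  (allIn R.car fun a => allIn Y.car fun x => ap₂ Y.smul a x fun y => ap Y.norm y fun s =>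
    ap Y.norm x fun r => exIn R.car fun t => R.isAbs a t ⋏ ap₂ R.times t r fun u => s ≐ u)

end NormedVars

/-! ### Functions from a metric space to a normed space -/

/-- `‖f(x)‖ < δ` -/
def normLt (R : RealVars) (Y : NormedVars) (f x δ : ℕ) : F :=
  ap f x fun y => ap Y.norm y fun r => R.lt r δ

/-- `f : X → Y` is uniformly continuous; the distance of `u` and `v` in `Y` is `‖u - v‖`. -/
def isUniformlyContinuous (R : RealVars) (X : MetricVars) (Y : NormedVars) (f : ℕ) : F :=
  R.allPos fun ε => R.exPos fun δ => allIn X.car fun x => allIn X.car fun x' =>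
    (X.d x x' fun a => R.lt a δ) ⟹
      ap f x fun u => ap f x' fun v => exIn Y.car fun c => (ap₂ Y.sum v c fun s => s ≐ u) ⋏
        ap Y.norm c fun r => R.lt r ε

/-- `Z = {x ∈ X : f(x) = 0}` -/
def isZeroSet (X : MetricVars) (Y : NormedVars) (f Z : ℕ) : F :=
  all fun x => iff (x ∊ Z) (x ∊ X.car ⋏ rel f x Y.zero)

/-- `f`, whose zero set is `Z`, is Z-stable at the point `x`. -/
def isZStableAt (R : RealVars) (X : MetricVars) (Y : NormedVars) (f Z x : ℕ) : F :=
  R.allPos fun ε => R.exPos fun δ => normLt R Y f x δ ⟹ X.near R x Z ε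

/-- `f`, whose zero set is `Z`, is Z-stable. -/
def isZStable (R : RealVars) (X : MetricVars) (Y : NormedVars) (f Z : ℕ) : F :=
  allIn X.car fun x => isZStableAt R X Y f Z x

/-- `f`, whose zero set is `Z`, is uniformly Z-stable. -/
def isUniformlyZStable (R : RealVars) (X : MetricVars) (Y : NormedVars) (f Z : ℕ) : F :=
  R.allPos fun ε => R.exPos fun δ => allIn X.car fun x =>
    normLt R Y f x δ ⟹ X.near R x Z ε

/-! ### Quantifiers over structures -/

/-- For `ω` and for the real numbers (the field of real numbers being unique up to isomorphism) -/
def forReals (φ : ℕ → RealVars → F) : F :=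
  all fun w => isOmega w ⟹
    all fun car => all fun plus => all fun times => all fun less => all fun o => all fun e =>
      RealVars.isReals ⟨car, plus, times, less, o, e⟩ w ⟹ φ w ⟨car, plus, times, less, o, e⟩

/-- For all metric spaces -/
def allMetric (R : RealVars) (φ : MetricVars → F) : F :=
  all fun car => all fun dist => MetricVars.isMetric ⟨car, dist⟩ R ⟹ φ ⟨car, dist⟩

/-- For all normed spaces -/
def allNormed (R : RealVars) (φ : NormedVars → F) : F :=
  all fun car => all fun sum => all fun smul => all fun o => all fun norm =>
    NormedVars.isNormed ⟨car, sum, smul, o, norm⟩ R ⟹ φ ⟨car, sum, smul, o, norm⟩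

end BISH

namespace BISH

/-! ### Renaming and derivations -/

/-! The analytic core is one auxiliary function. Fix ε > 0 and put g(x) = max(‖f(x)‖, ε - ρ(x, Z)).
Z-stability at x makes g(x) positive: with δ chosen for ε, cotransitivity gives 0 < ‖f(x)‖ or ‖f(x)‖
< δ, and in the second case some z in Z has ρ(x, z) < ε, so ρ(x, Z) < ε (`gaugeVal_pos`). The
function g is uniformly continuous because ‖f‖ is and because ρ(·, Z) is 1-Lipschitz
(`gaugeVal_le_add`, `gauge_uniformlyContinuous`). The positivity property therefore gives M = inf g
> 0. Take 0 < δ < M and let ‖f(x)‖ < δ. By cotransitivity ε - ρ(x, Z) is either positive, and then a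
point of Z lies within ε of x, or less than δ, which would give g(x) ≤ δ < M ≤ g(x)
(`near_of_gaugeVal`).

What has to be produced is an intuitionistic derivation. It is obtained from completeness for the
canonical Kripke model: worlds are prime theories with witnesses, formulas that are not derivable
are refuted in some world (`exists_world`), and truth in a world is membership in it
(`sat_iff_mem`), so a formula true in all worlds is derivable (`provable_of_forall_sat`). This
metatheorem is proved classically, but the argument carried out inside the model has to respect
forcing: disjunctions and existentials are genuine at the world where they hold, while implications,
negations and universal statements have to be checked at all later worlds, to which known facts are
carried by `Up.mono`.

Inside one world, the names of reals modulo equality form an actual commutative ring `RealsAt.Q`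
with a partial order and a separate cotransitive relation `RealsAt.Lt`, so the estimates become
ordinary algebra. Extensionality and pairing supply the calculus of ordered pairs and functions, the
least-upper-bound principle supplies binary maxima (`exists_max`), and strong collection turns g
into a set (`exists_gauge`). -/

theorem lift_comp (r s : ℕ → ℕ) : lift s ∘ lift r = lift (s ∘ r) := by
  funext n; cases n <;> rfl

theorem lift_id : lift id = id := by
  funext n; cases n <;> rfl

/-- Prepend a value to an assignment. -/
def cons (a : ℕ) (e : ℕ → ℕ) : ℕ → ℕ
  | 0 => a
  | n + 1 => e n

namespace Fm

theorem rename_rename (φ : Fm) : ∀ r s : ℕ → ℕ, (φ.rename r).rename s = φ.rename (s ∘ r) := by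
  induction φ with
  | mem i j => intros; rfl
  | eq i j => intros; rfl
  | bot => intros; rfl
  | and φ ψ h₁ h₂ => intro r s; simp only [rename, h₁, h₂]
  | or φ ψ h₁ h₂ => intro r s; simp only [rename, h₁, h₂]
  | imp φ ψ h₁ h₂ => intro r s; simp only [rename, h₁, h₂]
  | all φ h => intro r s; simp only [rename, h, lift_comp]
  | ex φ h => intro r s; simp only [rename, h, lift_comp]

theorem rename_id (φ : Fm) : φ.rename id = φ := by
  induction φ with
  | mem i j => rfl
  | eq i j => rfl
  | bot => rfl
  | and φ ψ h₁ h₂ => simp only [rename, h₁, h₂]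
  | or φ ψ h₁ h₂ => simp only [rename, h₁, h₂]
  | imp φ ψ h₁ h₂ => simp only [rename, h₁, h₂]
  | all φ h => simp only [rename, h, lift_id]
  | ex φ h => simp only [rename, h, lift_id]

theorem inst_eq (φ : Fm) (k : ℕ) : φ.inst k = φ.rename (cons k id) := by
  unfold inst; congr 1

theorem rename_inst (φ : Fm) (k : ℕ) (r : ℕ → ℕ) :
    (φ.inst k).rename r = (φ.rename (lift r)).inst (r k) := by
  simp only [inst_eq, rename_rename]; congr 1; funext n; cases n <;> rfl

/-- Instantiating the body of a renamed quantifier amounts to extending the assignment. This is the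
quantifier case of the truth lemma `sat_iff_mem`. -/
theorem rename_lift_inst (φ : Fm) (k : ℕ) (r : ℕ → ℕ) :
    (φ.rename (lift r)).inst k = φ.rename (cons k r) := by
  simp only [inst_eq, rename_rename]; congr 1; funext n; cases n <;> rfl

theorem shift_rename_lift (φ : Fm) (r : ℕ → ℕ) :
    φ.shift.rename (lift r) = (φ.rename r).shift := by
  simp only [shift, rename_rename]; rfl

theorem map_shift_rename_lift (Γ : List Fm) (r : ℕ → ℕ) :
    (Γ.map shift).map (rename (lift r)) = (Γ.map (rename r)).map shift := by
  simp only [List.map_map]; congr 1; funext φ; exact shift_rename_lift φ r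

/-- All free variables of the formula have the property `p`. -/
def On : (ℕ → Prop) → Fm → Prop
  | p, .mem i j => p i ∧ p j
  | p, .eq i j => p i ∧ p j
  | _, .bot => True
  | p, .and φ ψ => On p φ ∧ On p ψ
  | p, .or φ ψ => On p φ ∧ On p ψ
  | p, .imp φ ψ => On p φ ∧ On p ψ
  | p, .all φ => On (fun n => ∀ k, n = k + 1 → p k) φ
  | p, .ex φ => On (fun n => ∀ k, n = k + 1 → p k) φ

theorem On.mono {φ : Fm} : ∀ {p q : ℕ → Prop}, (∀ k, p k → q k) → φ.On p → φ.On q := by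
  induction φ with
  | mem i j => exact fun h H => ⟨h _ H.1, h _ H.2⟩
  | eq i j => exact fun h H => ⟨h _ H.1, h _ H.2⟩
  | bot => exact fun _ _ => trivial
  | and φ ψ h₁ h₂ => exact fun h H => ⟨h₁ h H.1, h₂ h H.2⟩
  | or φ ψ h₁ h₂ => exact fun h H => ⟨h₁ h H.1, h₂ h H.2⟩
  | imp φ ψ h₁ h₂ => exact fun h H => ⟨h₁ h H.1, h₂ h H.2⟩
  | all φ ih => exact fun h H => ih (fun n hn k hk => h k (hn k hk)) H
  | ex φ ih => exact fun h H => ih (fun n hn k hk => h k (hn k hk)) H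

theorem on_of_forall {φ : Fm} : ∀ {p : ℕ → Prop}, (∀ k, p k) → φ.On p := by
  induction φ with
  | mem i j => exact fun h => ⟨h _, h _⟩
  | eq i j => exact fun h => ⟨h _, h _⟩
  | bot => exact fun _ => trivial
  | and φ ψ h₁ h₂ => exact fun h => ⟨h₁ h, h₂ h⟩
  | or φ ψ h₁ h₂ => exact fun h => ⟨h₁ h, h₂ h⟩
  | imp φ ψ h₁ h₂ => exact fun h => ⟨h₁ h, h₂ h⟩
  | all φ ih => exact fun h => ih fun _ k _ => h k
  | ex φ ih => exact fun h => ih fun _ k _ => h k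

theorem on_rename {φ : Fm} :
    ∀ {p : ℕ → Prop} {r : ℕ → ℕ}, (φ.rename r).On p ↔ φ.On fun k => p (r k) := by
  induction φ with
  | mem i j => exact Iff.rfl
  | eq i j => exact Iff.rfl
  | bot => exact Iff.rfl
  | and φ ψ h₁ h₂ => exact and_congr h₁ h₂
  | or φ ψ h₁ h₂ => exact and_congr h₁ h₂
  | imp φ ψ h₁ h₂ => exact and_congr h₁ h₂
  | all φ ih =>
    intro p r
    refine ih.trans ⟨fun H => On.mono (φ := φ) ?_ H, fun H => On.mono (φ := φ) ?_ H⟩ <;>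
      rintro (_ | n) h k hk <;> simp_all [lift]
  | ex φ ih =>
    intro p r
    refine ih.trans ⟨fun H => On.mono (φ := φ) ?_ H, fun H => On.mono (φ := φ) ?_ H⟩ <;>
      rintro (_ | n) h k hk <;> simp_all [lift]

/-- Only the values at free variables matter. Hence abstracting a variable that does not occur is
the same as weakening. -/
theorem On.rename_congr {φ : Fm} : ∀ {p : ℕ → Prop} {r s : ℕ → ℕ}, φ.On p →
    (∀ k, p k → r k = s k) → φ.rename r = φ.rename s := by
  induction φ with
  | mem i j => intro p r s H h; simp only [rename, h _ H.1, h _ H.2]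
  | eq i j => intro p r s H h; simp only [rename, h _ H.1, h _ H.2]
  | bot => intros; rfl
  | and φ ψ h₁ h₂ => intro p r s H h; simp only [rename, h₁ H.1 h, h₂ H.2 h]
  | or φ ψ h₁ h₂ => intro p r s H h; simp only [rename, h₁ H.1 h, h₂ H.2 h]
  | imp φ ψ h₁ h₂ => intro p r s H h; simp only [rename, h₁ H.1 h, h₂ H.2 h]
  | all φ ih =>
    intro p r s H h
    simp only [rename]
    rw [ih H]
    rintro (_ | n) hn
    · rfl
    · simp only [lift, h n (hn n rfl)]
  | ex φ ih =>
    intro p r s H h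
    simp only [rename]
    rw [ih H]
    rintro (_ | n) hn
    · rfl
    · simp only [lift, h n (hn n rfl)]

/-- The free variables of a formula are bounded. -/
theorem exists_on_lt (φ : Fm) : ∃ N, φ.On (· < N) := by
  induction φ with
  | mem i j => exact ⟨i + j + 1, by constructor <;> omega⟩
  | eq i j => exact ⟨i + j + 1, by constructor <;> omega⟩
  | bot => exact ⟨0, trivial⟩
  | and φ ψ h₁ h₂ =>
    obtain ⟨⟨a, ha⟩, ⟨b, hb⟩⟩ := And.intro h₁ h₂
    exact ⟨a + b, ha.mono (by omega), hb.mono (by omega)⟩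
  | or φ ψ h₁ h₂ =>
    obtain ⟨⟨a, ha⟩, ⟨b, hb⟩⟩ := And.intro h₁ h₂
    exact ⟨a + b, ha.mono (by omega), hb.mono (by omega)⟩
  | imp φ ψ h₁ h₂ =>
    obtain ⟨⟨a, ha⟩, ⟨b, hb⟩⟩ := And.intro h₁ h₂
    exact ⟨a + b, ha.mono (by omega), hb.mono (by omega)⟩
  | all φ h => obtain ⟨a, ha⟩ := h; exact ⟨a, On.mono (φ := φ) (by intros; omega) ha⟩
  | ex φ h => obtain ⟨a, ha⟩ := h; exact ⟨a, On.mono (φ := φ) (by intros; omega) ha⟩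

theorem exists_on_lt_list (Γ : List Fm) : ∃ N, ∀ φ ∈ Γ, φ.On (· < N) := by
  induction Γ with
  | nil => exact ⟨0, by simp⟩
  | cons φ Γ h =>
    obtain ⟨a, ha⟩ := h
    obtain ⟨b, hb⟩ := φ.exists_on_lt
    refine ⟨a + b, fun ψ hψ => ?_⟩
    rcases List.mem_cons.1 hψ with rfl | hψ
    · exact hb.mono (by intros; omega)
    · exact (ha ψ hψ).mono (by intros; omega)

end Fm

/-! ### Stability of the axioms and of derivability under renaming -/

theorem IsBounded.rename {φ : Fm} (h : IsBounded φ) : ∀ r, IsBounded (φ.rename r) := by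
  induction h with
  | mem i j => exact fun r => .mem _ _
  | eq i j => exact fun r => .eq _ _
  | bot => exact fun r => .bot
  | and _ _ h₁ h₂ => exact fun r => .and (h₁ r) (h₂ r)
  | or _ _ h₁ h₂ => exact fun r => .or (h₁ r) (h₂ r)
  | imp _ _ h₁ h₂ => exact fun r => .imp (h₁ r) (h₂ r)
  | all k _ h => exact fun r => .all _ (h (lift r))
  | ex k _ h => exact fun r => .ex _ (h (lift r))

/-- In an instance of a scheme, `sub` reserves the first variables of `φ` for the bound ones, and
the others are parameters. A renaming of the parameters is thus an instance of the same scheme, with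
`φ` renamed under as many lifts as there are reserved variables: one here and for separation, two
for strong collection, three for subset collection. -/
theorem close_setInduction_rename (φ : Fm) (r : ℕ → ℕ) :
    (close (setInduction φ)).rename r = close (setInduction (φ.rename (lift r))) := by
  have h₁ : (sub φ [0] 1).rename (lift r) = sub (φ.rename (lift r)) [0] 1 := by
    simp only [sub, Fm.rename_rename]; congr 1; funext i; rcases i with _ | i <;> rfl
  have h₂ : (sub φ [1] 2).rename (lift (lift r)) = sub (φ.rename (lift r)) [1] 2 := by
    simp only [sub, Fm.rename_rename]; congr 1; funext i; rcases i with _ | i <;> rfl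
  simp only [close, setInduction, imp, all, allIn, mem, Fm.rename, Nat.zero_add, Nat.reduceAdd,
    h₁, h₂]
  rfl

theorem close_separation_rename (φ : Fm) (r : ℕ → ℕ) :
    (close (separation φ)).rename r = close (separation (φ.rename (lift r))) := by
  have h : (sub φ [2] 3).rename (lift (lift (lift r))) = sub (φ.rename (lift r)) [2] 3 := by
    simp only [sub, Fm.rename_rename]; congr 1; funext i; rcases i with _ | i <;> rfl
  simp only [close, separation, imp, all, ex, iff, and, mem, Fm.rename, Nat.zero_add,
    Nat.reduceAdd, h]
  rfl

theorem close_strongCollection_rename (φ : Fm) (r : ℕ → ℕ) :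
    (close (strongCollection φ)).rename r =
      close (strongCollection (φ.rename (lift (lift r)))) := by
  have h₁ : (sub φ [1, 2] 3).rename (lift (lift (lift r))) =
      sub (φ.rename (lift (lift r))) [1, 2] 3 := by
    simp only [sub, Fm.rename_rename]; congr 1; funext i; rcases i with _ | _ | i <;> rfl
  have h₂ : (sub φ [2, 3] 4).rename (lift (lift (lift (lift r)))) =
      sub (φ.rename (lift (lift r))) [2, 3] 4 := by
    simp only [sub, Fm.rename_rename]; congr 1; funext i; rcases i with _ | _ | i <;> rfl
  have h₃ : (sub φ [3, 2] 4).rename (lift (lift (lift (lift r)))) =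
      sub (φ.rename (lift (lift r))) [3, 2] 4 := by
    simp only [sub, Fm.rename_rename]; congr 1; funext i; rcases i with _ | _ | i <;> rfl
  simp only [close, strongCollection, totalBetween, imp, all, ex, allIn, exIn, and, mem,
    Fm.rename, Nat.zero_add, Nat.reduceAdd, h₁, h₂, h₃]
  rfl

theorem close_subsetCollection_rename (φ : Fm) (r : ℕ → ℕ) :
    (close (subsetCollection φ)).rename r =
      close (subsetCollection (φ.rename (lift (lift (lift r))))) := by
  have h₁ : (sub φ [4, 5, 3] 6).rename (lift (lift (lift (lift (lift (lift r)))))) =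
      sub (φ.rename (lift (lift (lift r)))) [4, 5, 3] 6 := by
    simp only [sub, Fm.rename_rename]; congr 1; funext i; rcases i with _ | _ | _ | i <;> rfl
  have h₂ : (sub φ [5, 6, 3] 7).rename (lift (lift (lift (lift (lift (lift (lift r))))))) =
      sub (φ.rename (lift (lift (lift r)))) [5, 6, 3] 7 := by
    simp only [sub, Fm.rename_rename]; congr 1; funext i; rcases i with _ | _ | _ | i <;> rfl
  have h₃ : (sub φ [6, 5, 3] 7).rename (lift (lift (lift (lift (lift (lift (lift r))))))) =
      sub (φ.rename (lift (lift (lift r)))) [6, 5, 3] 7 := by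
    simp only [sub, Fm.rename_rename]; congr 1; funext i; rcases i with _ | _ | _ | i <;> rfl
  simp only [close, subsetCollection, totalBetween, imp, all, ex, allIn, exIn, and, mem,
    Fm.rename, Nat.zero_add, Nat.reduceAdd, h₁, h₂, h₃]
  rfl

/-- In `Prf.allI` and `Prf.exE` the hypotheses are shifted but the axioms are not. Closure of the
axioms under renaming is what makes derivations renamable and makes axioms with parameters true
under every assignment. -/
theorem axioms_rename {φ : Fm} (h : φ ∈ axioms) (r : ℕ → ℕ) : φ.rename r ∈ axioms := by
  rcases h with h | rfl
  · refine Or.inl ?_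
    cases h with
    | extensionality => exact CZF.extensionality
    | pairing => exact CZF.pairing
    | union => exact CZF.union
    | infinity => exact CZF.infinity
    | setInduction φ => rw [close_setInduction_rename]; exact .setInduction _
    | separation φ h => rw [close_separation_rename]; exact .separation _ (h.rename _)
    | strongCollection φ => rw [close_strongCollection_rename]; exact .strongCollection _
    | subsetCollection φ => rw [close_subsetCollection_rename]; exact .subsetCollection _
  · exact Or.inr rfl

/-- Derivability from the axioms of BISH -/
abbrev Ded (Γ : List Fm) (φ : Fm) : Prop := Prf axioms Γ φ

theorem Ded.rename {Γ : List Fm} {φ : Fm} (h : Ded Γ φ) :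
    ∀ r, Ded (Γ.map (Fm.rename r)) (φ.rename r) := by
  induction h with
  | ax h => exact fun r => .ax (axioms_rename h r)
  | hyp h => exact fun r => .hyp (List.mem_map_of_mem h)
  | botE _ ih => exact fun r => .botE (ih r)
  | andI _ _ h₁ h₂ => exact fun r => .andI (h₁ r) (h₂ r)
  | andE₁ _ h => exact fun r => .andE₁ (h r)
  | andE₂ _ h => exact fun r => .andE₂ (h r)
  | orI₁ _ h => exact fun r => .orI₁ (h r)
  | orI₂ _ h => exact fun r => .orI₂ (h r)
  | orE _ _ _ h h₁ h₂ => exact fun r => .orE (h r) (h₁ r) (h₂ r)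
  | impI _ h => exact fun r => .impI (h r)
  | impE _ _ h₁ h₂ => exact fun r => .impE (h₁ r) (h₂ r)
  | allI _ h =>
    exact fun r => .allI (by rw [← Fm.map_shift_rename_lift]; exact h (lift r))
  | allE k _ h => exact fun r => by rw [Fm.rename_inst]; exact .allE _ (h r)
  | exI k _ h => exact fun r => .exI (r k) (by rw [← Fm.rename_inst]; exact h r)
  | exE _ _ h₁ h₂ =>
    refine fun r => .exE (h₁ r) ?_
    rw [← Fm.map_shift_rename_lift, ← Fm.shift_rename_lift]
    exact h₂ (lift r)
  | eqI i => exact fun r => .eqI _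
  | eqE _ _ h₁ h₂ =>
    intro r
    rw [Fm.rename_inst]
    exact .eqE (h₁ r) (by rw [← Fm.rename_inst]; exact h₂ r)

theorem Ded.weaken {Γ : List Fm} {φ : Fm} (h : Ded Γ φ) :
    ∀ {Δ : List Fm}, Γ ⊆ Δ → Ded Δ φ := by
  induction h with
  | ax h => exact fun _ => .ax h
  | hyp h => exact fun H => .hyp (H h)
  | botE _ ih => exact fun r => .botE (ih r)
  | andI _ _ h₁ h₂ => exact fun r => .andI (h₁ r) (h₂ r)
  | andE₁ _ h => exact fun r => .andE₁ (h r)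
  | andE₂ _ h => exact fun r => .andE₂ (h r)
  | orI₁ _ h => exact fun r => .orI₁ (h r)
  | orI₂ _ h => exact fun r => .orI₂ (h r)
  | orE _ _ _ h h₁ h₂ =>
    exact fun r => .orE (h r) (h₁ (List.cons_subset_cons _ r)) (h₂ (List.cons_subset_cons _ r))
  | impI _ h => exact fun r => .impI (h (List.cons_subset_cons _ r))
  | impE _ _ h₁ h₂ => exact fun r => .impE (h₁ r) (h₂ r)
  | allI _ h => exact fun r => .allI (h (List.map_subset _ r))
  | allE k _ h => exact fun r => .allE _ (h r)
  | exI k _ h => exact fun r => .exI k (h r)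
  | exE _ _ h₁ h₂ =>
    exact fun r => .exE (h₁ r) (h₂ (List.cons_subset_cons _ (List.map_subset _ r)))
  | eqI i => exact fun _ => .eqI _
  | eqE _ _ h₁ h₂ => exact fun r => .eqE (h₁ r) (h₂ r)

/-! ### Quantifier rules with a named fresh variable -/

/-- The renaming that makes the variable `c` the variable `0`, and shifts the others. -/
def abstractVar (c n : ℕ) : ℕ := if n = c then 0 else n + 1

theorem Fm.On.abstractVar {φ : Fm} {c : ℕ} (h : φ.On (· ≠ c)) :
    φ.rename (abstractVar c) = φ.shift :=
  h.rename_congr fun k hk => by simp [BISH.abstractVar, hk]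

theorem Fm.map_abstractVar {Γ : List Fm} {c : ℕ} (h : ∀ φ ∈ Γ, φ.On (· ≠ c)) :
    Γ.map (Fm.rename (BISH.abstractVar c)) = Γ.map Fm.shift :=
  List.map_congr_left fun φ hφ => (h φ hφ).abstractVar

theorem Fm.inst_abstractVar {φ : Fm} {c : ℕ} (h : (Fm.all φ).On (· ≠ c)) :
    (φ.inst c).rename (BISH.abstractVar c) = φ := by
  rw [inst_eq, rename_rename]
  conv_rhs => rw [← φ.rename_id]
  refine On.rename_congr h ?_
  rintro (_ | k) hk
  · simp [cons, BISH.abstractVar]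
  · simp [cons, BISH.abstractVar, hk k rfl]

/-- Generalization on a fresh variable -/
theorem Ded.all_of_fresh {Γ : List Fm} {φ : Fm} {c : ℕ} (hΓ : ∀ ψ ∈ Γ, ψ.On (· ≠ c))
    (hφ : (Fm.all φ).On (· ≠ c)) (h : Ded Γ (φ.inst c)) : Ded Γ (.all φ) := by
  have := h.rename (abstractVar c)
  rw [Fm.map_abstractVar hΓ, Fm.inst_abstractVar hφ] at this
  exact .allI this

/-- Existential elimination with a fresh variable -/
theorem Ded.ex_of_fresh {Γ : List Fm} {φ χ : Fm} {c : ℕ} (hΓ : ∀ ψ ∈ Γ, ψ.On (· ≠ c))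
    (hφ : (Fm.ex φ).On (· ≠ c)) (hχ : χ.On (· ≠ c)) (h₁ : Ded Γ (.ex φ))
    (h : Ded (φ.inst c :: Γ) χ) : Ded Γ χ := by
  have := h.rename (abstractVar c)
  rw [List.map_cons, Fm.map_abstractVar hΓ, Fm.inst_abstractVar hφ, hχ.abstractVar] at this
  exact .exE h₁ this

/-- Formulas are coded by numbers. -/
def Fm.code : Fm → ℕ
  | .mem i j => Nat.pair 0 (Nat.pair i j)
  | .eq i j => Nat.pair 1 (Nat.pair i j)
  | .bot => Nat.pair 2 0
  | .and φ ψ => Nat.pair 3 (Nat.pair φ.code ψ.code)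
  | .or φ ψ => Nat.pair 4 (Nat.pair φ.code ψ.code)
  | .imp φ ψ => Nat.pair 5 (Nat.pair φ.code ψ.code)
  | .all φ => Nat.pair 6 φ.code
  | .ex φ => Nat.pair 7 φ.code

theorem Fm.code_injective : Function.Injective Fm.code := by
  intro φ
  induction φ <;> intro ψ h <;> cases ψ <;>
    simp only [code, Nat.pair_eq_pair] at h <;> grind

/-! ### The canonical Kripke model -/

/-- Derivability from a set of hypotheses -/
def Der (S : Set Fm) (φ : Fm) : Prop := ∃ Γ : List Fm, (∀ ψ ∈ Γ, ψ ∈ S) ∧ Ded Γ φ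

namespace Der

variable {S S' : Set Fm} {φ ψ χ : Fm}

theorem hyp (h : φ ∈ S) : Der S φ := ⟨[φ], by simpa, .hyp (by simp)⟩

theorem mono (h : S ⊆ S') : Der S φ → Der S' φ :=
  fun ⟨Γ, hΓ, H⟩ => ⟨Γ, fun ψ hψ => h (hΓ ψ hψ), H⟩

/-- Finitely many cuts: each hypothesis is discharged into an implication and replaced by its own
derivation. -/
theorem of_ded {Γ : List Fm} (hΓ : ∀ ψ ∈ Γ, Der S ψ) (h : Ded Γ φ) : Der S φ := by
  induction Γ generalizing φ with
  | nil => exact ⟨[], by simp, h⟩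
  | cons ψ Γ ih =>
    obtain ⟨Δ, hΔ, H⟩ := ih (fun χ hχ => hΓ χ (List.mem_cons_of_mem _ hχ)) (.impI h)
    obtain ⟨Δ', hΔ', H'⟩ := hΓ ψ List.mem_cons_self
    refine ⟨Δ ++ Δ', fun χ hχ => (List.mem_append.1 hχ).elim (hΔ χ) (hΔ' χ), ?_⟩
    exact .impE (H.weaken (List.subset_append_left _ _)) (H'.weaken (List.subset_append_right _ _))

theorem insert_iff : Der (insert φ S) χ ↔ Der S (.imp φ χ) := by
  constructor
  · rintro ⟨Γ, hΓ, h⟩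
    classical
    refine ⟨Γ.filter (· ∈ S), by simp, .impI (h.weaken fun ψ hψ => ?_)⟩
    rcases hΓ ψ hψ with rfl | h'
    · simp
    · simp [hψ, h']
  · intro h
    refine of_ded (Γ := [.imp φ χ, φ]) ?_ (.impE (φ := φ) (.hyp (by simp)) (.hyp (by simp)))
    simpa using ⟨h.mono (Set.subset_insert _ _), hyp (Set.mem_insert _ _)⟩

theorem cut (h₁ : Der S φ) (h₂ : Der (insert φ S) χ) : Der S χ :=
  of_ded (Γ := [.imp φ χ, φ]) (by simpa using ⟨insert_iff.1 h₂, h₁⟩)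
    (.impE (φ := φ) (.hyp (by simp)) (.hyp (by simp)))

/-- Only finitely many hypotheses matter. -/
theorem of_iUnion {S : ℕ → Set Fm} (hS : Monotone S) (h : Der (⋃ n, S n) φ) :
    ∃ n, Der (S n) φ := by
  obtain ⟨Γ, hΓ, H⟩ := h
  suffices ∃ n, ∀ ψ ∈ Γ, ψ ∈ S n from this.imp fun n hn => ⟨Γ, hn, H⟩
  clear H
  induction Γ with
  | nil => exact ⟨0, by simp⟩
  | cons ψ Γ ih =>
    obtain ⟨n, hn⟩ := ih fun χ hχ => hΓ χ (List.mem_cons_of_mem _ hχ)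
    obtain ⟨m, hm⟩ := Set.mem_iUnion.1 (hΓ ψ List.mem_cons_self)
    refine ⟨max n m, fun χ hχ => ?_⟩
    rcases List.mem_cons.1 hχ with rfl | hχ
    · exact hS (le_max_right _ _) hm
    · exact hS (le_max_left _ _) (hn χ hχ)

end Der

/-- The variables available at level `n` -/
def Avail (n k : ℕ) : Prop := k.unpair.1 ≤ n

theorem Avail.mono {n m k : ℕ} (h : n ≤ m) (hk : Avail n k) : Avail m k := le_trans hk h

/-- Each level adds infinitely many new variables, the codes of pairs with first entry n + 1. A
Henkin construction over level n thus never runs out of witnesses. -/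
theorem exists_avail_ge (n N : ℕ) : ∃ k, Avail (n + 1) k ∧ ¬ Avail n k ∧ N ≤ k :=
  ⟨Nat.pair (n + 1) N, by simp [Avail], by simp [Avail], Nat.right_le_pair _ _⟩

/-- A world is a prime theory with witnesses, in the language whose constants are the variables of
some level. -/
structure World where
  level : ℕ
  carrier : Set Fm
  on_avail : ∀ φ ∈ carrier, φ.On (Avail level)
  closed : ∀ φ : Fm, φ.On (Avail level) → Der carrier φ → φ ∈ carrier
  bot_notMem : Fm.bot ∉ carrier
  or_mem : ∀ φ ψ, Fm.or φ ψ ∈ carrier → φ ∈ carrier ∨ ψ ∈ carrier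
  ex_mem : ∀ φ, Fm.ex φ ∈ carrier → ∃ k, Avail level k ∧ φ.inst k ∈ carrier

/-- The variables available at its level are the individuals of a world, so a later world may have
more individuals as well as more truths. -/
instance : Preorder World where
  le w w' := w.level ≤ w'.level ∧ w.carrier ⊆ w'.carrier
  le_refl w := ⟨le_rfl, subset_rfl⟩
  le_trans _ _ _ h h' := ⟨h.1.trans h'.1, h.2.trans h'.2⟩

/-- Since `On` has the same clause for both quantifiers, this also applies to existential formulas.
-/
theorem Fm.On.inst {φ : Fm} {p : ℕ → Prop} {k : ℕ} (h : (Fm.all φ).On p) (hk : p k) :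
    (φ.inst k).On p := by
  rw [inst_eq, on_rename]
  refine On.mono (φ := φ) ?_ h
  rintro (_ | n) hn
  · exact hk
  · exact hn n rfl

/-- `L` is a finite set of formulas that contains `φ`, with a witness if `φ` is an existential formula,
and that does not make `χ` derivable. -/
def Witnessed (φ : Fm) (n : ℕ) (S : Set Fm) (χ : Fm) (L : Set Fm) : Prop :=
  L.Finite ∧ φ ∈ L ∧ (∀ ψ ∈ L, ψ.On (Avail n)) ∧ (¬ Der (S ∪ L) χ) ∧
    ∀ ψ, φ = .ex ψ → ∃ k, Avail n k ∧ ψ.inst k ∈ L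

theorem exists_fresh {n : ℕ} {S L : Set Fm} (hS : ∀ ψ ∈ S, ψ.On (Avail n)) (hL : L.Finite) :
    ∃ k, Avail (n + 1) k ∧ (∀ ψ ∈ S, ψ.On (· ≠ k)) ∧ ∀ ψ ∈ L, ψ.On (· ≠ k) := by
  obtain ⟨N, hN⟩ := Fm.exists_on_lt_list hL.toFinset.toList
  obtain ⟨k, hk, hk', hNk⟩ := exists_avail_ge n N
  refine ⟨k, hk, fun ψ hψ => (hS ψ hψ).mono fun i hi hik => hk' (hik ▸ hi), fun ψ hψ => ?_⟩
  exact (hN ψ (by simpa)).mono (by intros; omega)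

/-- If adding φ is harmless, so is adding a witness at a fresh variable when φ is existential: a
derivation of χ from the witness becomes one from φ by existential elimination. -/
theorem exists_witnessed {n : ℕ} {S L : Set Fm} {φ χ : Fm} (hS : ∀ ψ ∈ S, ψ.On (Avail n))
    (hL : L.Finite) (hLn : ∀ ψ ∈ L, ψ.On (Avail (n + 1)))
    (hφ : φ.On (Avail (n + 1))) (h : ¬ Der (insert φ (S ∪ L)) χ) :
    ∃ L', L ⊆ L' ∧ Witnessed φ (n + 1) S χ L' := by
  by_cases hex : ∃ ψ, φ = .ex ψ
  · obtain ⟨ψ, rfl⟩ := hex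
    -- Freshness for χ, φ and L is imposed separately, since only S is confined to level n. It is
    -- possible because these formulas are finite in number.
    obtain ⟨k, hk, hSk, hLk⟩ := exists_fresh hS ((hL.insert (.ex ψ)).insert χ)
    refine ⟨insert (ψ.inst k) (insert (.ex ψ) L), by grind, (hL.insert _).insert _, by simp, ?_,
      ?_, ?_⟩
    · rintro θ (rfl | rfl | hθ)
      · exact Fm.On.inst (φ := ψ) hφ hk
      · exact hφ
      · exact hLn θ hθ
    · intro hd
      rw [Set.union_insert, Set.union_insert] at hd
      refine h ?_
      obtain ⟨Γ, hΓ, H⟩ := Der.insert_iff.1 hd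
      refine ⟨.ex ψ :: Γ, ?_, ?_⟩
      · rintro θ hθ
        rcases List.mem_cons.1 hθ with rfl | hθ
        · simp
        · exact hΓ θ hθ
      · refine Ded.ex_of_fresh (c := k) ?_ (hLk _ (by simp)) (hLk _ (by simp))
          (.hyp (φ := .ex ψ) (by simp)) ?_
        · rintro θ hθ
          rcases List.mem_cons.1 hθ with rfl | hθ
          · exact hLk _ (by simp)
          · rcases hΓ θ hθ with rfl | hθ | hθ
            · exact hLk _ (by simp)
            · exact hSk _ hθ
            · exact hLk _ (by simp [hθ])
        · exact .impE (φ := ψ.inst k) (H.weaken (by intro; simp; tauto)) (.hyp (by simp))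
    · rintro _ ⟨⟩
      exact ⟨k, hk, by simp⟩
  · refine ⟨insert φ L, by grind, hL.insert _, by simp, ?_, ?_, fun ψ hψ => (hex ⟨ψ, hψ⟩).elim⟩
    · rintro θ (rfl | hθ)
      · exact hφ
      · exact hLn θ hθ
    · rwa [Set.union_insert]

/-- A set of formulas that does not derive `χ` extends to a world that does not contain `χ`. -/
theorem exists_world {n : ℕ} {S : Set Fm} {χ : Fm} (hS : ∀ ψ ∈ S, ψ.On (Avail n))
    (h : ¬ Der S χ) :
    ∃ w : World, w.level = n + 1 ∧ S ⊆ w.carrier ∧ χ ∉ w.carrier := by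
  classical
  -- A state is the finite set of formulas added so far. Finiteness keeps fresh variables available
  -- at every stage.
  let State := {L : Set Fm // L.Finite ∧ (∀ ψ ∈ L, ψ.On (Avail (n + 1))) ∧ ¬ Der (S ∪ L) χ}
  have step : ∀ (m : ℕ) (L : State), ∃ L' : State, L.1 ⊆ L'.1 ∧ ∀ φ : Fm, φ.code = m →
      φ.On (Avail (n + 1)) → ¬ Der (insert φ (S ∪ L.1)) χ →
      φ ∈ L'.1 ∧ ∀ ψ, φ = .ex ψ → ∃ k, Avail (n + 1) k ∧ ψ.inst k ∈ L'.1 := by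
    intro m L
    by_cases hm : ∃ φ : Fm, φ.code = m ∧ φ.On (Avail (n + 1)) ∧ ¬ Der (insert φ (S ∪ L.1)) χ
    · obtain ⟨φ, rfl, hφ, hd⟩ := hm
      obtain ⟨L', hL, h₁, h₂, h₃, h₄, h₅⟩ := exists_witnessed hS L.2.1 L.2.2.1 hφ hd
      refine ⟨⟨L', h₁, h₃, h₄⟩, hL, fun ψ hψ _ _ => ?_⟩
      obtain rfl := Fm.code_injective hψ
      exact ⟨h₂, h₅⟩
    · exact ⟨L, subset_rfl, fun φ h₁ h₂ h₃ => (hm ⟨φ, h₁, h₂, h₃⟩).elim⟩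
  choose next hnext hnext' using step
  let L : ℕ → State := fun m => Nat.rec ⟨∅, by simp, by simp, by simpa⟩ (fun m L => next m L) m
  have hLsucc : ∀ m, (L m).1 ⊆ (L (m + 1)).1 := fun m => hnext m (L m)
  have hLmono : Monotone fun m => S ∪ (L m).1 :=
    monotone_nat_of_le_succ fun m => Set.union_subset_union_right _ (hLsucc m)
  have hU : ¬ Der (⋃ m, S ∪ (L m).1) χ := fun hd =>
    let ⟨m, hm⟩ := Der.of_iUnion hLmono hd
    (L m).2.2.2 hm
  set U := ⋃ m, S ∪ (L m).1 with hUdef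
  have hLU : ∀ m, S ∪ (L m).1 ⊆ U := fun m => Set.subset_iUnion (fun m => S ∪ (L m).1) m
  -- The union is maximal among sets not deriving χ: a formula harmless for the union was harmless
  -- at the stage given by its code, and was added then, with a witness if existential. Closure,
  -- primeness and witnesses all follow.
  have key : ∀ φ : Fm, φ.On (Avail (n + 1)) → ¬ Der (insert φ U) χ →
      φ ∈ U ∧ ∀ ψ, φ = .ex ψ → ∃ k, Avail (n + 1) k ∧ ψ.inst k ∈ U := by
    intro φ hφ hd
    obtain ⟨h₁, h₂⟩ := hnext' φ.code (L φ.code) φ rfl hφ fun hd' =>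
      hd (hd'.mono (Set.insert_subset_insert (hLU _)))
    refine ⟨hLU (φ.code + 1) (Or.inr h₁), fun ψ hψ => ?_⟩
    obtain ⟨k, hk, hk'⟩ := h₂ ψ hψ
    exact ⟨k, hk, hLU (φ.code + 1) (Or.inr hk')⟩
  have hUon : ∀ φ ∈ U, φ.On (Avail (n + 1)) := by
    intro φ hφ
    obtain ⟨m, hm | hm⟩ := Set.mem_iUnion.1 hφ
    · exact (hS φ hm).mono fun k => Avail.mono (Nat.le_succ n)
    · exact (L m).2.2.1 φ hm
  have hclosed : ∀ φ : Fm, φ.On (Avail (n + 1)) → Der U φ → φ ∈ U := fun φ hφ hd =>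
    (key φ hφ fun hd' => hU (hd.cut hd')).1
  refine ⟨⟨n + 1, U, hUon, hclosed, ?_, ?_, ?_⟩, rfl, fun φ hφ => hLU 0 (Or.inl hφ),
    fun hχ => hU (.hyp hχ)⟩
  · exact fun hb => hU (.of_ded (Γ := [.bot]) (by simpa using Der.hyp hb) (.botE (.hyp (by simp))))
  · intro φ ψ hφψ
    by_contra! hn
    have hon := hUon _ hφψ
    have h₁ : Der (insert φ U) χ := by
      by_contra hd; exact hn.1 (key φ hon.1 hd).1
    have h₂ : Der (insert ψ U) χ := by
      by_contra hd; exact hn.2 (key ψ hon.2 hd).1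
    refine hU (.of_ded (Γ := [.or φ ψ, .imp φ χ, .imp ψ χ]) ?_ (.orE (φ := φ) (ψ := ψ)
      (.hyp (by simp)) (.impE (φ := φ) (.hyp (by simp)) (.hyp (by simp)))
      (.impE (φ := ψ) (.hyp (by simp)) (.hyp (by simp)))))
    simpa using ⟨Der.hyp hφψ, Der.insert_iff.1 h₁, Der.insert_iff.1 h₂⟩
  · intro φ hφ
    exact (key (.ex φ) (hUon _ hφ) fun hd => hU ((Der.hyp hφ).cut hd)).2 φ rfl

/-! ### Membership in a world obeys the forcing clauses -/

namespace World

variable (w : World) {φ ψ : Fm}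

theorem mem_of_ded {Γ : List Fm} (hφ : φ.On (Avail w.level)) (hΓ : ∀ ψ ∈ Γ, ψ ∈ w.carrier)
    (h : Ded Γ φ) : φ ∈ w.carrier :=
  w.closed φ hφ ⟨Γ, hΓ, h⟩

theorem and_mem_iff : Fm.and φ ψ ∈ w.carrier ↔ φ ∈ w.carrier ∧ ψ ∈ w.carrier := by
  refine ⟨fun h => ⟨?_, ?_⟩, fun h => ?_⟩
  · exact w.mem_of_ded (Γ := [.and φ ψ]) (w.on_avail _ h).1 (by simpa)
      (.andE₁ (ψ := ψ) (.hyp (by simp)))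
  · exact w.mem_of_ded (Γ := [.and φ ψ]) (w.on_avail _ h).2 (by simpa)
      (.andE₂ (φ := φ) (.hyp (by simp)))
  · exact w.mem_of_ded (Γ := [φ, ψ]) ⟨w.on_avail _ h.1, w.on_avail _ h.2⟩ (by simpa)
      (.andI (.hyp (by simp)) (.hyp (by simp)))

theorem or_mem_iff (h : (Fm.or φ ψ).On (Avail w.level)) :
    Fm.or φ ψ ∈ w.carrier ↔ φ ∈ w.carrier ∨ ψ ∈ w.carrier := by
  refine ⟨w.or_mem φ ψ, fun h' => h'.elim (fun h' => ?_) (fun h' => ?_)⟩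
  · exact w.mem_of_ded (Γ := [φ]) h (by simpa) (.orI₁ (.hyp (by simp)))
  · exact w.mem_of_ded (Γ := [ψ]) h (by simpa) (.orI₂ (.hyp (by simp)))

/-- For the converse, if the world together with φ did not derive ψ, it would extend to a later
world containing φ but not ψ. -/
theorem imp_mem_iff (h : (Fm.imp φ ψ).On (Avail w.level)) : Fm.imp φ ψ ∈ w.carrier ↔
    ∀ w', w ≤ w' → φ ∈ w'.carrier → ψ ∈ w'.carrier := by
  constructor
  · intro hi w' hw hφ
    exact w'.mem_of_ded (Γ := [.imp φ ψ, φ]) (h.2.mono fun k => Avail.mono hw.1)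
      (by simpa using ⟨hw.2 hi, hφ⟩) (.impE (φ := φ) (.hyp (by simp)) (.hyp (by simp)))
  · intro H
    refine w.closed _ h (Der.insert_iff.1 ?_)
    by_contra hd
    obtain ⟨w', hl, hS, hψ⟩ := exists_world (n := w.level)
      (by rintro θ (rfl | hθ); exacts [h.1, w.on_avail _ hθ]) hd
    exact hψ (H w' ⟨by omega, (Set.subset_insert _ _).trans hS⟩ (hS (Set.mem_insert _ _)))

/-- For the converse, if the universal formula is not derivable, neither is its instance at a fresh
variable, and some later world omits that instance. -/
theorem all_mem_iff (h : (Fm.all φ).On (Avail w.level)) : Fm.all φ ∈ w.carrier ↔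
    ∀ w', w ≤ w' → ∀ k, Avail w'.level k → φ.inst k ∈ w'.carrier := by
  constructor
  · intro ha w' hw k hk
    exact w'.mem_of_ded (Γ := [.all φ])
      (Fm.On.inst (Fm.On.mono (φ := .all φ) (fun k => Avail.mono hw.1) h) hk)
      (by simpa using hw.2 ha) (.allE k (.hyp (by simp)))
  · intro H
    refine w.closed _ h ?_
    by_contra hd
    obtain ⟨c, hc, hwc, hφc⟩ := exists_fresh w.on_avail (Set.finite_singleton (Fm.all φ))
    obtain ⟨w', hl, hS, hψ⟩ := exists_world (n := w.level + 1) (S := w.carrier) (χ := φ.inst c)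
      (fun θ hθ => (w.on_avail _ hθ).mono fun k => Avail.mono (Nat.le_succ _))
      (fun ⟨Γ, hΓ, hd'⟩ => hd ⟨Γ, hΓ, Ded.all_of_fresh (fun θ hθ => hwc θ (hΓ θ hθ))
        (hφc _ rfl) hd'⟩)
    exact hψ (H w' ⟨by omega, hS⟩ c (hc.mono (by omega)))

theorem ex_mem_iff (h : (Fm.ex φ).On (Avail w.level)) : Fm.ex φ ∈ w.carrier ↔
    ∃ k, Avail w.level k ∧ φ.inst k ∈ w.carrier :=
  ⟨w.ex_mem φ, fun ⟨k, _, h'⟩ =>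
    w.mem_of_ded (Γ := [φ.inst k]) h (by simpa) (.exI k (.hyp (by simp)))⟩

end World

/-! ### Truth in the canonical model -/

/-- Persistent properties of worlds -/
structure Up where
  Holds : World → Prop
  mono : ∀ {w w'}, w ≤ w' → Holds w → Holds w'

notation:50 w:51 " ⊩ " A:51 => Up.Holds A w

namespace K

def mem (a b : ℕ) : Up := ⟨fun w => Fm.mem a b ∈ w.carrier, fun h h' => h.2 h'⟩
def eq (a b : ℕ) : Up := ⟨fun w => Fm.eq a b ∈ w.carrier, fun h h' => h.2 h'⟩
def bot : Up := ⟨fun _ => False, fun _ h => h⟩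
def and (A B : Up) : Up :=
  ⟨fun w => A.Holds w ∧ B.Holds w, fun h h' => ⟨A.mono h h'.1, B.mono h h'.2⟩⟩
def or (A B : Up) : Up := ⟨fun w => A.Holds w ∨ B.Holds w, fun h => Or.imp (A.mono h) (B.mono h)⟩
def imp (A B : Up) : Up :=
  ⟨fun w => ∀ w', w ≤ w' → A.Holds w' → B.Holds w', fun h h' w' hw => h' w' (h.trans hw)⟩
def all (A : ℕ → Up) : Up :=
  ⟨fun w => ∀ w', w ≤ w' → ∀ a, Avail w'.level a → (A a).Holds w',
    fun h h' w' hw => h' w' (h.trans hw)⟩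
def ex (A : ℕ → Up) : Up :=
  ⟨fun w => ∃ a, Avail w.level a ∧ (A a).Holds w,
    fun h ⟨a, ha, h'⟩ => ⟨a, ha.mono h.1, (A a).mono h h'⟩⟩

end K

infix:55 " ∈ₖ " => K.mem
infix:55 " =ₖ " => K.eq
infixr:35 " ∧ₖ " => K.and
infixr:30 " ∨ₖ " => K.or
infixr:25 " →ₖ " => K.imp

/-- Truth of a formula under an assignment -/
def sat : Fm → (ℕ → ℕ) → Up
  | .mem i j, e => e i ∈ₖ e j
  | .eq i j, e => e i =ₖ e j
  | .bot, _ => K.bot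
  | .and φ ψ, e => sat φ e ∧ₖ sat ψ e
  | .or φ ψ, e => sat φ e ∨ₖ sat ψ e
  | .imp φ ψ, e => sat φ e →ₖ sat ψ e
  | .all φ, e => K.all fun a => sat φ (cons a e)
  | .ex φ, e => K.ex fun a => sat φ (cons a e)

theorem cons_avail {w : World} {a : ℕ} {e : ℕ → ℕ} (ha : Avail w.level a)
    (he : ∀ i, Avail w.level (e i)) : ∀ i, Avail w.level (cons a e i)
  | 0 => ha
  | n + 1 => he n

theorem rename_on_avail {w : World} {e : ℕ → ℕ} (he : ∀ i, Avail w.level (e i)) (φ : Fm) :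
    (φ.rename e).On (Avail w.level) :=
  Fm.on_rename.2 (Fm.on_of_forall he)

/-- A formula is true in a world when it belongs to it. -/
theorem sat_iff_mem (φ : Fm) : ∀ {w : World} {e : ℕ → ℕ}, (∀ i, Avail w.level (e i)) →
    ((w ⊩ sat φ e) ↔ φ.rename e ∈ w.carrier) := by
  induction φ with
  | mem i j => exact fun _ => Iff.rfl
  | eq i j => exact fun _ => Iff.rfl
  | bot => exact fun {w} _ _ => ⟨False.elim, w.bot_notMem⟩
  | and φ ψ h₁ h₂ => exact fun {w} _ he => (and_congr (h₁ he) (h₂ he)).trans w.and_mem_iff.symm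
  | or φ ψ h₁ h₂ =>
    exact fun {w} _ he => (or_congr (h₁ he) (h₂ he)).trans
      (w.or_mem_iff (rename_on_avail he (.or φ ψ))).symm
  | imp φ ψ h₁ h₂ =>
    intro w e he
    refine Iff.trans ?_ (w.imp_mem_iff (rename_on_avail he (.imp φ ψ))).symm
    refine forall_congr' fun w' => forall_congr' fun hw => ?_
    have he' := fun i => (he i).mono hw.1
    exact imp_congr (h₁ he') (h₂ he')
  | all φ h =>
    intro w e he
    refine Iff.trans ?_ (w.all_mem_iff (rename_on_avail he (.all φ))).symm
    refine forall_congr' fun w' => forall_congr' fun hw => forall_congr' fun a =>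
      forall_congr' fun ha => ?_
    rw [Fm.rename_lift_inst]
    exact h (cons_avail ha fun i => (he i).mono hw.1)
  | ex φ h =>
    intro w e he
    refine Iff.trans ?_ (w.ex_mem_iff (rename_on_avail he (.ex φ))).symm
    refine exists_congr fun a => and_congr_right fun ha => ?_
    rw [Fm.rename_lift_inst]
    exact h (cons_avail ha he)

theorem sat_of_mem_axioms {φ : Fm} (h : φ ∈ axioms) {w : World} {e : ℕ → ℕ}
    (he : ∀ i, Avail w.level (e i)) : w ⊩ sat φ e :=
  (sat_iff_mem φ he).2 (w.mem_of_ded (Γ := []) (rename_on_avail he φ) (by simp)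
    (.ax (axioms_rename h e)))

/-- Completeness of the canonical model -/
theorem provable_of_forall_sat {φ : Fm}
    (h : ∀ (w : World) (e : ℕ → ℕ), (∀ i, Avail w.level (e i)) → w ⊩ sat φ e) :
    Prf axioms [] φ := by
  by_contra hφ
  have hav : ∀ i, Avail 0 (Nat.pair 0 i) := fun i => by simp [Avail]
  -- Pairing with 0 moves all free variables into level 0, and `Nat.unpair` recovers them, so the
  -- renamed formula is derivable only if φ is.
  obtain ⟨w, -, -, hw⟩ := exists_world (n := 0) (S := ∅) (χ := φ.rename (Nat.pair 0)) (by simp) (by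
    rintro ⟨Γ, hΓ, hd⟩
    obtain rfl : Γ = [] := List.eq_nil_iff_forall_not_mem.2 hΓ
    have := hd.rename fun n => n.unpair.2
    have hid : φ.rename ((fun n => n.unpair.2) ∘ Nat.pair 0) = φ := by
      refine Eq.trans ?_ φ.rename_id
      congr 1
      funext n
      simp
    rw [Fm.rename_rename, hid] at this
    exact hφ this)
  have he : ∀ i, Avail w.level (Nat.pair 0 i) := fun i => (hav i).mono (Nat.zero_le _)
  exact hw ((sat_iff_mem φ he).1 (h w _ he))

theorem sat_rename (φ : Fm) : ∀ (r e : ℕ → ℕ), sat (φ.rename r) e = sat φ (e ∘ r) := by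
  have hc : ∀ (a : ℕ) (r e : ℕ → ℕ), cons a e ∘ lift r = cons a (e ∘ r) := by
    intro a r e; funext n; cases n <;> rfl
  induction φ with
  | mem i j => intros; rfl
  | eq i j => intros; rfl
  | bot => intros; rfl
  | and φ ψ h₁ h₂ => intro r e; simp only [Fm.rename, sat, h₁, h₂]
  | or φ ψ h₁ h₂ => intro r e; simp only [Fm.rename, sat, h₁, h₂]
  | imp φ ψ h₁ h₂ => intro r e; simp only [Fm.rename, sat, h₁, h₂]
  | all φ h => intro r e; simp only [Fm.rename, sat, h, hc]
  | ex φ h => intro r e; simp only [Fm.rename, sat, h, hc]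

/-! ### Equality -/

section Equality

variable {w : World} {a a' b b' c : ℕ}

theorem avail_left_of_mem (h : w ⊩ a ∈ₖ b) : Avail w.level a := (w.on_avail _ h).1
theorem avail_right_of_mem (h : w ⊩ a ∈ₖ b) : Avail w.level b := (w.on_avail _ h).2
theorem avail_left_of_eq (h : w ⊩ a =ₖ b) : Avail w.level a := (w.on_avail _ h).1
theorem avail_right_of_eq (h : w ⊩ a =ₖ b) : Avail w.level b := (w.on_avail _ h).2

theorem eq_refl (h : Avail w.level a) : w ⊩ a =ₖ a :=
  w.mem_of_ded (Γ := []) ⟨h, h⟩ (by simp) (.eqI a)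

theorem eq_symm (h : w ⊩ a =ₖ b) : w ⊩ b =ₖ a :=
  w.mem_of_ded (Γ := [.eq a b]) ⟨avail_right_of_eq h, avail_left_of_eq h⟩
    (List.forall_mem_singleton.2 h) (.eqE (φ := .eq 0 (a + 1)) (i := a) (j := b) (.hyp (by simp)) (.eqI a))

theorem eq_trans (h : w ⊩ a =ₖ b) (h' : w ⊩ b =ₖ c) : w ⊩ a =ₖ c :=
  w.mem_of_ded (Γ := [.eq a b, .eq b c]) ⟨avail_left_of_eq h, avail_right_of_eq h'⟩
    (List.forall_mem_cons.2 ⟨h, List.forall_mem_singleton.2 h'⟩)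
    (.eqE (φ := .eq (a + 1) 0) (i := b) (j := c) (.hyp (by simp))
      (.hyp (by simp [Fm.inst, Fm.rename])))

theorem mem_congr (h : w ⊩ a ∈ₖ b) (ha : w ⊩ a =ₖ a') (hb : w ⊩ b =ₖ b') : w ⊩ a' ∈ₖ b' :=
  w.mem_of_ded (Γ := [.mem a b, .eq a a', .eq b b']) ⟨avail_right_of_eq ha, avail_right_of_eq hb⟩
    (List.forall_mem_cons.2 ⟨h, List.forall_mem_cons.2 ⟨ha, List.forall_mem_singleton.2 hb⟩⟩)
    (.eqE (φ := .mem (a' + 1) 0) (i := b) (j := b') (.hyp (by simp))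
      (.eqE (φ := .mem 0 (b + 1)) (i := a) (j := a') (.hyp (by simp))
        (.hyp (by simp [Fm.inst, Fm.rename]))))

/-- Equality in a world need not be identity of names. This substitution principle is what lets
names be replaced by equal ones in every notion defined by a formula. -/
theorem sat_congr (φ : Fm) : ∀ {w : World} {e e' : ℕ → ℕ}, (∀ i, w ⊩ e i =ₖ e' i) →
    (w ⊩ sat φ e) → w ⊩ sat φ e' := by
  have hc : ∀ {w : World} {e e' : ℕ → ℕ}, (∀ i, w ⊩ e i =ₖ e' i) → ∀ {a}, Avail w.level a →
      ∀ i, w ⊩ cons a e i =ₖ cons a e' i := by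
    intro w e e' h a ha i
    cases i with
    | zero => exact eq_refl ha
    | succ n => exact h n
  induction φ with
  | mem i j => exact fun h h' => mem_congr h' (h i) (h j)
  | eq i j => exact fun h h' => eq_trans (eq_symm (h i)) (eq_trans h' (h j))
  | bot => exact fun _ h' => h'
  | and φ ψ h₁ h₂ => exact fun h h' => ⟨h₁ h h'.1, h₂ h h'.2⟩
  | or φ ψ h₁ h₂ => exact fun h h' => h'.imp (h₁ h) (h₂ h)
  | imp φ ψ h₁ h₂ =>
    intro w e e' h h' w' hw hφ
    have hw' := fun i => (e i =ₖ e' i).mono hw (h i)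
    exact h₂ hw' (h' w' hw (h₁ (fun i => eq_symm (hw' i)) hφ))
  | all φ ih =>
    exact fun {w e e'} h h' w' hw a ha =>
      ih (hc (fun i => (e i =ₖ e' i).mono hw (h i)) ha) (h' w' hw a ha)
  | ex φ ih => exact fun h ⟨a, ha, h'⟩ => ⟨a, ha, ih (hc h ha) h'⟩

end Equality

/-! ### The notions of the statement, read in the canonical model -/

namespace K

/-- Each clause copies the corresponding formula with forcing connectives in place of syntactic
ones. The truth value of the formula is then the copy by definition, so axioms and hypotheses can be
used in this form without translation. -/
def not (φ : Up) : Up := φ →ₖ bot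
def iff (φ ψ : Up) : Up := (φ →ₖ ψ) ∧ₖ (ψ →ₖ φ)
def allIn (a : ℕ) (φ : ℕ → Up) : Up := all fun x => x ∈ₖ a →ₖ φ x
def exIn (a : ℕ) (φ : ℕ → Up) : Up := ex fun x => x ∈ₖ a ∧ₖ φ x
def isUPair (z x y : ℕ) : Up := all fun w => iff (w ∈ₖ z) (w =ₖ x ∨ₖ w =ₖ y)
def isPair (p x y : ℕ) : Up := all fun z => iff (z ∈ₖ p) (isUPair z x x ∨ₖ isUPair z x y)
def rel (r x y : ℕ) : Up := ex fun p => isPair p x y ∧ₖ p ∈ₖ r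
def isProd (c a b : ℕ) : Up :=
  all fun p => iff (p ∈ₖ c) (exIn a fun x => exIn b fun y => isPair p x y)
def isSubset (a b : ℕ) : Up := allIn a fun x => x ∈ₖ b
def isFun (f a b : ℕ) : Up :=
  (allIn f fun p => exIn a fun x => exIn b fun y => isPair p x y) ∧ₖ
  (allIn a fun x => exIn b fun y => rel f x y) ∧ₖ
  (all fun x => all fun y => all fun y' => rel f x y →ₖ rel f x y' →ₖ y =ₖ y')
def isFun₂ (f a b c : ℕ) : Up := ex fun q => isProd q a b ∧ₖ isFun f q c
def ap (f x : ℕ) (φ : ℕ → Up) : Up := ex fun y => rel f x y ∧ₖ φ y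
def ap₂ (f x y : ℕ) (φ : ℕ → Up) : Up := ex fun p => isPair p x y ∧ₖ ap f p φ

def lt (R : RealVars) (x y : ℕ) : Up := rel R.less x y

def le (R : RealVars) (x y : ℕ) : Up := not (lt R y x)

def pos (R : RealVars) (x : ℕ) : Up := lt R R.zero x

def allPos (R : RealVars) (φ : ℕ → Up) : Up := allIn R.car fun e => pos R e →ₖ φ e

def exPos (R : RealVars) (φ : ℕ → Up) : Up := exIn R.car fun e => pos R e ∧ₖ φ e

def isField (R : RealVars) : Up :=
  R.zero ∈ₖ R.car ∧ₖ R.one ∈ₖ R.car ∧ₖ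
  isFun₂ R.plus R.car R.car R.car ∧ₖ isFun₂ R.times R.car R.car R.car ∧ₖ
  (allIn R.car fun x => allIn R.car fun y => allIn R.car fun z =>
    ap₂ R.plus x y fun u => ap₂ R.plus u z fun s =>
      ap₂ R.plus y z fun v => ap₂ R.plus x v fun t => s =ₖ t) ∧ₖ
  (allIn R.car fun x => allIn R.car fun y =>
    ap₂ R.plus x y fun s => ap₂ R.plus y x fun t => s =ₖ t) ∧ₖ
  (allIn R.car fun x => ap₂ R.plus x R.zero fun s => s =ₖ x) ∧ₖ
  (allIn R.car fun x => exIn R.car fun y => ap₂ R.plus x y fun s => s =ₖ R.zero) ∧ₖ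
  (allIn R.car fun x => allIn R.car fun y => allIn R.car fun z =>
    ap₂ R.times x y fun u => ap₂ R.times u z fun s =>
      ap₂ R.times y z fun v => ap₂ R.times x v fun t => s =ₖ t) ∧ₖ
  (allIn R.car fun x => allIn R.car fun y =>
    ap₂ R.times x y fun s => ap₂ R.times y x fun t => s =ₖ t) ∧ₖ
  (allIn R.car fun x => ap₂ R.times x R.one fun s => s =ₖ x) ∧ₖ
  (allIn R.car fun x => allIn R.car fun y => allIn R.car fun z =>
    ap₂ R.plus y z fun u => ap₂ R.times x u fun s =>
      ap₂ R.times x y fun v => ap₂ R.times x z fun w => ap₂ R.plus v w fun t => s =ₖ t) ∧ₖ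
  (allPos R fun x => exPos R fun y => ap₂ R.times x y fun s => s =ₖ R.one)

def isOrdered (R : RealVars) : Up :=
  lt R R.zero R.one ∧ₖ
  (allIn R.car fun x => allIn R.car fun y => not (lt R x y ∧ₖ lt R y x)) ∧ₖ
  (allIn R.car fun x => allIn R.car fun y => lt R x y →ₖ
    allIn R.car fun z => lt R x z ∨ₖ lt R z y) ∧ₖ
  (allIn R.car fun x => allIn R.car fun y => le R x y →ₖ le R y x →ₖ x =ₖ y) ∧ₖ
  (allIn R.car fun x => allIn R.car fun y => lt R x y →ₖ
    allIn R.car fun z => ap₂ R.plus x z fun s => ap₂ R.plus y z fun t => lt R s t) ∧ₖ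
  (allPos R fun x => allPos R fun y => ap₂ R.times x y fun s => pos R s)

def isCompleteField (R : RealVars) : Up :=
  all fun S => isSubset S R.car →ₖ (ex fun s => s ∈ₖ S) →ₖ
    (exIn R.car fun b => allIn S fun s => le R s b) →ₖ
    (allIn R.car fun a => allIn R.car fun b => lt R a b →ₖ
      (allIn S fun s => le R s b) ∨ₖ (exIn S fun s => lt R a s)) →ₖ
    exIn R.car fun m => (allIn S fun s => le R s m) ∧ₖ
      (allIn R.car fun a => lt R a m →ₖ exIn S fun s => lt R a s)

def isAbs (R : RealVars) (a t : ℕ) : Up :=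
  exIn R.car fun b => (ap₂ R.plus a b fun s => s =ₖ R.zero) ∧ₖ t ∈ₖ R.car ∧ₖ
    le R a t ∧ₖ le R b t ∧ₖ allIn R.car fun s => le R a s →ₖ le R b s →ₖ le R t s

def isInf (R : RealVars) (S m : ℕ) (v : ℕ → (ℕ → Up) → Up) : Up :=
  m ∈ₖ R.car ∧ₖ (allIn S fun x => v x fun e => le R m e) ∧ₖ
  (allPos R fun ε => exIn S fun x => v x fun e => ap₂ R.plus m ε fun t => lt R e t)

def d (X : MetricVars) (x y : ℕ) (φ : ℕ → Up) : Up := ap₂ X.dist x y φ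

def isMetric (X : MetricVars) (R : RealVars) : Up :=
  isFun₂ X.dist X.car X.car R.car ∧ₖ
  (allIn X.car fun x => allIn X.car fun y => d X x y fun a => le R R.zero a) ∧ₖ
  (allIn X.car fun x => allIn X.car fun y => d X x y fun a => iff (a =ₖ R.zero) (x =ₖ y)) ∧ₖ
  (allIn X.car fun x => allIn X.car fun y => d X x y fun a => d X y x fun b => a =ₖ b) ∧ₖ
  (allIn X.car fun x => allIn X.car fun y => allIn X.car fun z =>
    d X x z fun a => d X x y fun b => d X y z fun c => ap₂ R.plus b c fun s => le R a s)

def near (X : MetricVars) (R : RealVars) (x S ε : ℕ) : Up :=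
  exIn S fun y => d X x y fun a => lt R a ε

def isLocated (X : MetricVars) (R : RealVars) (S : ℕ) : Up :=
  allIn X.car fun x => ex fun m => isInf R S m fun y => d X x y

def isUniformlyContinuousReal (X : MetricVars) (R : RealVars) (g : ℕ) : Up :=
  allPos R fun ε => exPos R fun δ => allIn X.car fun x => allIn X.car fun y =>
    (d X x y fun a => lt R a δ) →ₖ
      ap g x fun u => ap g y fun v => exIn R.car fun c => (ap₂ R.plus v c fun s => s =ₖ u) ∧ₖ
        exIn R.car fun t => isAbs R c t ∧ₖ lt R t ε

def hasPositivity (X : MetricVars) (R : RealVars) : Up :=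
  all fun g => isFun g X.car R.car →ₖ isUniformlyContinuousReal X R g →ₖ
    (allIn X.car fun x => ap g x fun u => pos R u) →ₖ
    exPos R fun m => isInf R X.car m fun x => ap g x

def normLt (R : RealVars) (Y : NormedVars) (f x δ : ℕ) : Up :=
  ap f x fun y => ap Y.norm y fun r => lt R r δ

def isUniformlyContinuous (R : RealVars) (X : MetricVars) (Y : NormedVars) (f : ℕ) : Up :=
  allPos R fun ε => exPos R fun δ => allIn X.car fun x => allIn X.car fun x' =>
    (d X x x' fun a => lt R a δ) →ₖ
      ap f x fun u => ap f x' fun v => exIn Y.car fun c => (ap₂ Y.sum v c fun s => s =ₖ u) ∧ₖ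
        ap Y.norm c fun r => lt R r ε

def isZeroSet (X : MetricVars) (Y : NormedVars) (f Z : ℕ) : Up :=
  all fun x => iff (x ∈ₖ Z) (x ∈ₖ X.car ∧ₖ rel f x Y.zero)

def isZStableAt (R : RealVars) (X : MetricVars) (Y : NormedVars) (f Z x : ℕ) : Up :=
  allPos R fun ε => exPos R fun δ => normLt R Y f x δ →ₖ near X R x Z ε

def isZStable (R : RealVars) (X : MetricVars) (Y : NormedVars) (f Z : ℕ) : Up :=
  allIn X.car fun x => isZStableAt R X Y f Z x

def isUniformlyZStable (R : RealVars) (X : MetricVars) (Y : NormedVars) (f Z : ℕ) : Up :=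
  allPos R fun ε => exPos R fun δ => allIn X.car fun x =>
    normLt R Y f x δ →ₖ near X R x Z ε

end K

/-! ### Elementary set theory in the canonical model -/

section SetTheory

variable {w : World} {a b c p p' q r r' x x' y y' z z' f : ℕ} {A B : Up} {φ ψ : ℕ → Up}

theorem imp_elim (h : w ⊩ (A →ₖ B)) (hA : w ⊩ A) : w ⊩ B := h w le_rfl hA

theorem all_elim (h : w ⊩ K.all φ) (ha : Avail w.level a) : w ⊩ φ a := h w le_rfl a ha

theorem iff_elim (h : w ⊩ K.iff A B) : (w ⊩ A) ↔ w ⊩ B := ⟨imp_elim h.1, imp_elim h.2⟩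

theorem allIn_elim (h : w ⊩ K.allIn a φ) (hx : w ⊩ x ∈ₖ a) : w ⊩ φ x :=
  imp_elim (all_elim h (avail_left_of_mem hx)) hx

theorem allIn_intro (h : ∀ w', w ≤ w' → ∀ x, (w' ⊩ x ∈ₖ a) → w' ⊩ φ x) : w ⊩ K.allIn a φ :=
  fun _ hw x _ w'' hw' hx => h w'' (hw.trans hw') x hx

theorem exIn_intro (hx : w ⊩ x ∈ₖ a) (h : w ⊩ φ x) : w ⊩ K.exIn a φ :=
  ⟨x, avail_left_of_mem hx, hx, h⟩

theorem exIn_elim (h : w ⊩ K.exIn a φ) : ∃ x, (w ⊩ x ∈ₖ a) ∧ w ⊩ φ x :=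
  let ⟨x, _, hx, h⟩ := h
  ⟨x, hx, h⟩

theorem ext (ha : Avail w.level a) (hb : Avail w.level b)
    (h : ∀ w', w ≤ w' → ∀ x, (w' ⊩ x ∈ₖ a) ↔ w' ⊩ x ∈ₖ b) : w ⊩ a =ₖ b := by
  have H : w ⊩ K.all fun a => K.all fun b => (K.all fun x => K.iff (x ∈ₖ a) (x ∈ₖ b)) →ₖ a =ₖ b :=
    sat_of_mem_axioms (Or.inl CZF.extensionality) (e := fun _ => a) fun _ => ha
  exact imp_elim (all_elim (all_elim H ha) hb) fun w' hw x _ =>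
    ⟨fun w'' hw' => (h w'' (hw.trans hw') x).1, fun w'' hw' => (h w'' (hw.trans hw') x).2⟩

theorem exists_upair (hx : Avail w.level x) (hy : Avail w.level y) :
    ∃ z, Avail w.level z ∧ w ⊩ K.isUPair z x y := by
  have H : w ⊩ K.all fun a => K.all fun b => K.ex fun c => K.isUPair c a b :=
    sat_of_mem_axioms (Or.inl CZF.pairing) (e := fun _ => x) fun _ => hx
  exact all_elim (all_elim H hx) hy

/-- Strong collection, for a relation defined by a formula -/
theorem strongCollection_elim (φ : Fm) {e : ℕ → ℕ} (he : ∀ i, Avail w.level (e i))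
    (ha : Avail w.level a)
    (h : w ⊩ K.allIn a fun x => K.ex fun y => sat φ (cons x (cons y e))) :
    ∃ b, Avail w.level b ∧
      (w ⊩ K.allIn a fun x => K.exIn b fun y => sat φ (cons x (cons y e))) ∧
      w ⊩ K.allIn b fun y => K.exIn a fun x => sat φ (cons x (cons y e)) := by
  have h₁ : ∀ a x y, sat (sub φ [1, 2] 3) (cons y (cons x (cons a e))) =
      sat φ (cons x (cons y e)) := by
    intros; unfold sub; rw [sat_rename]; congr 1; funext i; rcases i with _ | _ | i <;> rfl
  have h₂ : ∀ a b x y, sat (sub φ [2, 3] 4) (cons y (cons x (cons b (cons a e)))) =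
      sat φ (cons x (cons y e)) := by
    intros; unfold sub; rw [sat_rename]; congr 1; funext i; rcases i with _ | _ | i <;> rfl
  have h₃ : ∀ a b x y, sat (sub φ [3, 2] 4) (cons x (cons y (cons b (cons a e)))) =
      sat φ (cons x (cons y e)) := by
    intros; unfold sub; rw [sat_rename]; congr 1; funext i; rcases i with _ | _ | i <;> rfl
  have H : w ⊩ K.all fun a =>
      (K.allIn a fun x => K.ex fun y => sat (sub φ [1, 2] 3) (cons y (cons x (cons a e)))) →ₖ
      K.ex fun b =>
        (K.allIn a fun x => K.exIn b fun y =>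
          sat (sub φ [2, 3] 4) (cons y (cons x (cons b (cons a e))))) ∧ₖ
        (K.allIn b fun y => K.exIn a fun x =>
          sat (sub φ [3, 2] 4) (cons x (cons y (cons b (cons a e))))) :=
    sat_of_mem_axioms (Or.inl (CZF.strongCollection φ)) he
  simp only [h₁, h₂, h₃] at H
  exact imp_elim (all_elim H ha) h

theorem mem_upair (h : w ⊩ K.isUPair z x y) :
    (w ⊩ a ∈ₖ z) ↔ (w ⊩ a =ₖ x) ∨ w ⊩ a =ₖ y := by
  constructor
  · exact fun ha => (iff_elim (all_elim h (avail_left_of_mem ha))).1 ha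
  · intro ha
    have hav : Avail w.level a := ha.elim avail_left_of_eq avail_left_of_eq
    exact (iff_elim (all_elim h hav)).2 ha

theorem mem_pair (h : w ⊩ K.isPair p x y) (ha : Avail w.level a) :
    (w ⊩ a ∈ₖ p) ↔ (w ⊩ K.isUPair a x x) ∨ w ⊩ K.isUPair a x y :=
  iff_elim (all_elim h ha)

theorem upair_unique (hz : Avail w.level z) (hz' : Avail w.level z') (h : w ⊩ K.isUPair z x y)
    (h' : w ⊩ K.isUPair z' x y) : w ⊩ z =ₖ z' :=
  ext hz hz' fun _ hw _ =>
    (mem_upair ((K.isUPair z x y).mono hw h)).trans (mem_upair ((K.isUPair z' x y).mono hw h')).symm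

theorem pair_unique (hp : Avail w.level p) (hp' : Avail w.level p') (h : w ⊩ K.isPair p x y)
    (h' : w ⊩ K.isPair p' x y) : w ⊩ p =ₖ p' := by
  refine ext hp hp' fun w' hw a => ⟨fun ha => ?_, fun ha => ?_⟩
  · exact (mem_pair ((K.isPair p' x y).mono hw h') (avail_left_of_mem ha)).2
      ((mem_pair ((K.isPair p x y).mono hw h) (avail_left_of_mem ha)).1 ha)
  · exact (mem_pair ((K.isPair p x y).mono hw h) (avail_left_of_mem ha)).2
      ((mem_pair ((K.isPair p' x y).mono hw h') (avail_left_of_mem ha)).1 ha)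

theorem upair_congr (hz : w ⊩ z =ₖ z') (hx : w ⊩ x =ₖ x') (hy : w ⊩ y =ₖ y')
    (h : w ⊩ K.isUPair z x y) : w ⊩ K.isUPair z' x' y' := by
  -- The formula is taken at depth 3, where the level names 0, 1, 2 are the indices 2, 1, 0; hence
  -- the reversed order of the assignment.
  refine sat_congr (isUPair 0 1 2 3) (e := cons y (cons x fun _ => z))
    (e' := cons y' (cons x' fun _ => z')) ?_ h
  rintro (_ | _ | i)
  exacts [hy, hx, hz]

theorem pair_congr (hp : w ⊩ p =ₖ p') (hx : w ⊩ x =ₖ x') (hy : w ⊩ y =ₖ y')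
    (h : w ⊩ K.isPair p x y) : w ⊩ K.isPair p' x' y' := by
  refine sat_congr (isPair 0 1 2 3) (e := cons y (cons x fun _ => p))
    (e' := cons y' (cons x' fun _ => p')) ?_ h
  rintro (_ | _ | i)
  exacts [hy, hx, hp]

theorem rel_congr (hr : w ⊩ r =ₖ r') (hx : w ⊩ x =ₖ x') (hy : w ⊩ y =ₖ y')
    (h : w ⊩ K.rel r x y) : w ⊩ K.rel r' x' y' := by
  refine sat_congr (rel 0 1 2 3) (e := cons y (cons x fun _ => r))
    (e' := cons y' (cons x' fun _ => r')) ?_ h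
  rintro (_ | _ | i)
  exacts [hy, hx, hr]

theorem exists_pair (hx : Avail w.level x) (hy : Avail w.level y) :
    ∃ p, Avail w.level p ∧ w ⊩ K.isPair p x y := by
  obtain ⟨u, hu, hux⟩ := exists_upair hx hx
  obtain ⟨v, hv, hvy⟩ := exists_upair hx hy
  obtain ⟨p, hp, hpuv⟩ := exists_upair hu hv
  refine ⟨p, hp, fun w' hw z hz => ?_⟩
  have key : ∀ w'', w' ≤ w'' →
      ((w'' ⊩ z ∈ₖ p) ↔ (w'' ⊩ K.isUPair z x x) ∨ w'' ⊩ K.isUPair z x y) := by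
    intro w'' hw'
    have hww := hw.trans hw'
    have hux' := (K.isUPair u x x).mono hww hux
    have hvy' := (K.isUPair v x y).mono hww hvy
    rw [mem_upair ((K.isUPair p u v).mono hww hpuv)]
    refine or_congr ⟨fun h => ?_, fun h => ?_⟩ ⟨fun h => ?_, fun h => ?_⟩
    · have := eq_refl (hx.mono hww.1)
      exact upair_congr (eq_symm h) this this hux'
    · exact upair_unique (hz.mono hw'.1) (hu.mono hww.1) h hux'
    · exact upair_congr (eq_symm h) (eq_refl (hx.mono hww.1)) (eq_refl (hy.mono hww.1)) hvy'
    · exact upair_unique (hz.mono hw'.1) (hv.mono hww.1) h hvy'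
  exact ⟨fun w'' hw' => (key w'' hw').1, fun w'' hw' => (key w'' hw').2⟩

/-- A Kuratowski argument without deciding whether x = y: `key` gives equal first entries and
locates y in {x', y'}. Used in both directions, it leaves only the case y = x' and y' = x, where
everything is equal. -/
theorem pair_injective (hx : Avail w.level x) (hy : Avail w.level y) (hx' : Avail w.level x')
    (hy' : Avail w.level y') (h : w ⊩ K.isPair p x y) (h' : w ⊩ K.isPair p x' y') :
    (w ⊩ x =ₖ x') ∧ w ⊩ y =ₖ y' := by
  have key : ∀ {x y x' y' : ℕ}, Avail w.level x → Avail w.level y → Avail w.level x' →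
      Avail w.level y' → (w ⊩ K.isPair p x y) → (w ⊩ K.isPair p x' y') →
      (w ⊩ x' =ₖ x) ∧ ((w ⊩ y =ₖ x') ∨ w ⊩ y =ₖ y') := by
    intro x y x' y' hx hy hx' hy' h h'
    obtain ⟨u, hu, hux⟩ := exists_upair hx hx
    obtain ⟨v, hv, hvy⟩ := exists_upair hx hy
    have h₁ := (mem_pair h' hu).1 ((mem_pair h hu).2 (Or.inl hux))
    have h₂ := (mem_pair h' hv).1 ((mem_pair h hv).2 (Or.inr hvy))
    have hyv : w ⊩ y ∈ₖ v := (mem_upair hvy).2 (Or.inr (eq_refl hy))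
    constructor
    · have hxu : w ⊩ x' ∈ₖ u := h₁.elim
        (fun h₁ => (mem_upair h₁).2 (Or.inl (eq_refl hx')))
        (fun h₁ => (mem_upair h₁).2 (Or.inl (eq_refl hx')))
      exact ((mem_upair hux).1 hxu).elim id id
    · rcases h₂ with h₂ | h₂
      · exact Or.inl (((mem_upair h₂).1 hyv).elim id id)
      · exact (mem_upair h₂).1 hyv
  obtain ⟨hxx, hyy⟩ := key hx hy hx' hy' h h'
  obtain ⟨-, hyy'⟩ := key hx' hy' hx hy h' h
  refine ⟨eq_symm hxx, ?_⟩
  rcases hyy with hyy | hyy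
  · rcases hyy' with hyy' | hyy'
    · exact eq_trans hyy (eq_trans hxx (eq_symm hyy'))
    · exact eq_symm hyy'
  · exact hyy

/-! ### Functions -/

/-- `f(x, y) = z` -/
def K.rel₂ (f x y z : ℕ) : Up := K.ex fun p => K.isPair p x y ∧ₖ K.rel f p z

theorem avail_of_rel (h : w ⊩ K.rel r x y) : Avail w.level r :=
  let ⟨_, _, h⟩ := h
  avail_right_of_mem h.2

theorem avail_of_rel₂ (h : w ⊩ K.rel₂ r x y z) : Avail w.level r :=
  let ⟨_, _, _, h⟩ := h
  avail_of_rel h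

theorem ap_elim (h : w ⊩ K.ap f x φ) : ∃ y, Avail w.level y ∧ (w ⊩ K.rel f x y) ∧ w ⊩ φ y := h

theorem ap₂_elim (h : w ⊩ K.ap₂ f x y φ) :
    ∃ z, Avail w.level z ∧ (w ⊩ K.rel₂ f x y z) ∧ w ⊩ φ z :=
  let ⟨p, hp, h, z, hz, h', h''⟩ := h
  ⟨z, hz, ⟨p, hp, h, h'⟩, h''⟩

theorem ap₂_intro (hz : Avail w.level z) (h : w ⊩ K.rel₂ f x y z) (h' : w ⊩ φ z) :
    w ⊩ K.ap₂ f x y φ :=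
  let ⟨p, hp, h, h''⟩ := h
  ⟨p, hp, h, z, hz, h'', h'⟩

theorem rel_mem (hf : w ⊩ K.isFun f a b) (hx : Avail w.level x) (hy : Avail w.level y)
    (h : w ⊩ K.rel f x y) : (w ⊩ x ∈ₖ a) ∧ w ⊩ y ∈ₖ b := by
  obtain ⟨p, hp, hpxy, hpf⟩ := h
  obtain ⟨x', hx', h'⟩ := exIn_elim (allIn_elim hf.1 hpf)
  obtain ⟨y', hy', h'⟩ := exIn_elim h'
  obtain ⟨h₁, h₂⟩ := pair_injective hx hy (avail_left_of_mem hx') (avail_left_of_mem hy') hpxy h'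
  exact ⟨mem_congr hx' (eq_symm h₁) (eq_refl (avail_right_of_mem hx')),
    mem_congr hy' (eq_symm h₂) (eq_refl (avail_right_of_mem hy'))⟩

theorem rel_total (hf : w ⊩ K.isFun f a b) (hx : w ⊩ x ∈ₖ a) :
    ∃ y, (w ⊩ y ∈ₖ b) ∧ w ⊩ K.rel f x y :=
  exIn_elim (allIn_elim hf.2.1 hx)

theorem rel_unique (hf : w ⊩ K.isFun f a b) (hx : Avail w.level x) (hy : Avail w.level y)
    (hy' : Avail w.level y') (h : w ⊩ K.rel f x y) (h' : w ⊩ K.rel f x y') : w ⊩ y =ₖ y' :=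
  imp_elim (imp_elim (all_elim (all_elim (all_elim hf.2.2 hx) hy) hy') h) h'

theorem rel₂_congr (hf : Avail w.level f) (hx : w ⊩ x =ₖ x') (hy : w ⊩ y =ₖ y')
    (hz : w ⊩ z =ₖ z') (h : w ⊩ K.rel₂ f x y z) : w ⊩ K.rel₂ f x' y' z' := by
  obtain ⟨p, hp, h, h'⟩ := h
  exact ⟨p, hp, pair_congr (eq_refl hp) hx hy h, rel_congr (eq_refl hf) (eq_refl hp) hz h'⟩

theorem rel₂_total (hf : w ⊩ K.isFun₂ f a b c) (hx : w ⊩ x ∈ₖ a) (hy : w ⊩ y ∈ₖ b) :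
    ∃ z, (w ⊩ z ∈ₖ c) ∧ w ⊩ K.rel₂ f x y z := by
  obtain ⟨q, -, hq, hf⟩ := hf
  obtain ⟨p, hp, hpxy⟩ := exists_pair (avail_left_of_mem hx) (avail_left_of_mem hy)
  have hpq : w ⊩ p ∈ₖ q :=
    (iff_elim (all_elim hq hp)).2 (exIn_intro hx (exIn_intro hy hpxy))
  obtain ⟨z, hz, h⟩ := rel_total hf hpq
  exact ⟨z, hz, p, hp, hpxy, h⟩

theorem rel₂_mem (hf : w ⊩ K.isFun₂ f a b c) (hz : Avail w.level z) (h : w ⊩ K.rel₂ f x y z) :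
    w ⊩ z ∈ₖ c :=
  let ⟨_, _, _, hf⟩ := hf
  let ⟨_, hp, _, h⟩ := h
  (rel_mem hf hp hz h).2

theorem rel₂_unique (hf : w ⊩ K.isFun₂ f a b c) (hz : Avail w.level z) (hz' : Avail w.level z')
    (h : w ⊩ K.rel₂ f x y z) (h' : w ⊩ K.rel₂ f x y z') : w ⊩ z =ₖ z' := by
  obtain ⟨q, -, hq, hf⟩ := hf
  obtain ⟨p, hp, h₁, h₂⟩ := h
  obtain ⟨p', hp', h₁', h₂'⟩ := h'
  have hpp := pair_unique hp' hp h₁' h₁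
  exact rel_unique hf hp hz hz' h₂ (rel_congr (eq_refl (avail_of_rel h₂')) hpp (eq_refl hz') h₂')

end SetTheory

/-! ### The real numbers of a world -/

/-- In the world `w`, the axioms of the field of real numbers hold. -/
structure RealsAt (w : World) (R : RealVars) : Prop where
  field : w ⊩ K.isField R
  ordered : w ⊩ K.isOrdered R
  complete : w ⊩ K.isCompleteField R

theorem RealsAt.mono {w w' : World} {R : RealVars} (h : RealsAt w R) (hw : w ≤ w') :
    RealsAt w' R :=
  ⟨Up.mono _ hw h.field, Up.mono _ hw h.ordered, Up.mono _ hw h.complete⟩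

namespace RealsAt

variable {w w' : World} {R : RealVars} {a b c a' b' : ℕ}

theorem zero_mem (h : RealsAt w R) : w ⊩ R.zero ∈ₖ R.car := h.field.1
theorem one_mem (h : RealsAt w R) : w ⊩ R.one ∈ₖ R.car := h.field.2.1
theorem plus_fun (h : RealsAt w R) : w ⊩ K.isFun₂ R.plus R.car R.car R.car := h.field.2.2.1
theorem times_fun (h : RealsAt w R) : w ⊩ K.isFun₂ R.times R.car R.car R.car := h.field.2.2.2.1

variable (h : RealsAt w R)

/-- The reals named by a variable, up to equality in the world -/
def setoid (_ : RealsAt w R) : Setoid {a // w ⊩ a ∈ₖ R.car} where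
  r a b := w ⊩ a.1 =ₖ b.1
  iseqv := ⟨fun a => eq_refl (avail_left_of_mem a.2), eq_symm, eq_trans⟩

/-- The set of real numbers of the world `w` -/
def Q : Type := Quotient h.setoid

def el (ha : w ⊩ a ∈ₖ R.car) : h.Q := Quotient.mk h.setoid ⟨a, ha⟩

theorem el_eq_el {ha : w ⊩ a ∈ₖ R.car} {hb : w ⊩ b ∈ₖ R.car} :
    h.el ha = h.el hb ↔ w ⊩ a =ₖ b :=
  ⟨fun h' => Quotient.exact h', fun h' => Quotient.sound h'⟩

variable {h} in
theorem exists_el (q : h.Q) : ∃ (a : ℕ) (ha : w ⊩ a ∈ₖ R.car), q = h.el ha :=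
  let ⟨⟨a, ha⟩, h'⟩ := Quotient.exists_rep q
  ⟨a, ha, h'.symm⟩

/-- Totality gives a value, and uniqueness and congruence make it independent of the names. An
internal operation thus becomes an operation on the quotient, described by its graph. -/
theorem exists_rel₂ {op : ℕ} (hop : w ⊩ K.isFun₂ op R.car R.car R.car) (x y : h.Q) :
    ∃ z : h.Q, ∀ a b c (ha : w ⊩ a ∈ₖ R.car) (hb : w ⊩ b ∈ₖ R.car) (hc : w ⊩ c ∈ₖ R.car),
      x = h.el ha → y = h.el hb → ((w ⊩ K.rel₂ op a b c) ↔ z = h.el hc) := by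
  obtain ⟨a, ha, rfl⟩ := exists_el x
  obtain ⟨b, hb, rfl⟩ := exists_el y
  obtain ⟨c, hc, H⟩ := rel₂_total hop ha hb
  have hav := avail_of_rel₂ H
  refine ⟨h.el hc, fun a' b' c' ha' hb' hc' haa hbb => ?_⟩
  rw [el_eq_el] at haa hbb ⊢
  have H' := rel₂_congr hav haa hbb (eq_refl (avail_left_of_mem hc)) H
  exact ⟨fun h' => rel₂_unique hop (avail_left_of_mem hc) (avail_left_of_mem hc') H' h',
    fun h' => rel₂_congr hav (eq_refl (avail_left_of_mem ha')) (eq_refl (avail_left_of_mem hb')) h' H'⟩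

noncomputable instance : Add h.Q := ⟨fun x y => (h.exists_rel₂ h.plus_fun x y).choose⟩
noncomputable instance : Mul h.Q := ⟨fun x y => (h.exists_rel₂ h.times_fun x y).choose⟩
instance : Zero h.Q := ⟨h.el h.zero_mem⟩
instance : One h.Q := ⟨h.el h.one_mem⟩

theorem el_zero : h.el h.zero_mem = 0 := rfl
theorem el_one : h.el h.one_mem = 1 := rfl

theorem add_eq_iff (ha : w ⊩ a ∈ₖ R.car) (hb : w ⊩ b ∈ₖ R.car) (hc : w ⊩ c ∈ₖ R.car) :
    h.el ha + h.el hb = h.el hc ↔ w ⊩ K.rel₂ R.plus a b c :=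
  ((h.exists_rel₂ h.plus_fun _ _).choose_spec a b c ha hb hc rfl rfl).symm

theorem mul_eq_iff (ha : w ⊩ a ∈ₖ R.car) (hb : w ⊩ b ∈ₖ R.car) (hc : w ⊩ c ∈ₖ R.car) :
    h.el ha * h.el hb = h.el hc ↔ w ⊩ K.rel₂ R.times a b c :=
  ((h.exists_rel₂ h.times_fun _ _).choose_spec a b c ha hb hc rfl rfl).symm

/-- The dictionary that turns nested internal applications into equations in `Q`. -/
theorem ap₂_plus_iff (ha : w ⊩ a ∈ₖ R.car) (hb : w ⊩ b ∈ₖ R.car) {φ : ℕ → Up} :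
    (w ⊩ K.ap₂ R.plus a b φ) ↔
      ∃ (c : ℕ) (hc : w ⊩ c ∈ₖ R.car), h.el ha + h.el hb = h.el hc ∧ w ⊩ φ c := by
  constructor
  · intro H
    obtain ⟨c, hc, h₁, h₂⟩ := ap₂_elim H
    have hc' := rel₂_mem h.plus_fun hc h₁
    exact ⟨c, hc', (h.add_eq_iff ha hb hc').2 h₁, h₂⟩
  · rintro ⟨c, hc, h₁, h₂⟩
    exact ap₂_intro (avail_left_of_mem hc) ((h.add_eq_iff ha hb hc).1 h₁) h₂

theorem ap₂_times_iff (ha : w ⊩ a ∈ₖ R.car) (hb : w ⊩ b ∈ₖ R.car) {φ : ℕ → Up} :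
    (w ⊩ K.ap₂ R.times a b φ) ↔
      ∃ (c : ℕ) (hc : w ⊩ c ∈ₖ R.car), h.el ha * h.el hb = h.el hc ∧ w ⊩ φ c := by
  constructor
  · intro H
    obtain ⟨c, hc, h₁, h₂⟩ := ap₂_elim H
    have hc' := rel₂_mem h.times_fun hc h₁
    exact ⟨c, hc', (h.mul_eq_iff ha hb hc').2 h₁, h₂⟩
  · rintro ⟨c, hc, h₁, h₂⟩
    exact ap₂_intro (avail_left_of_mem hc) ((h.mul_eq_iff ha hb hc).1 h₁) h₂

theorem exists_neg (x : h.Q) : ∃ y, x + y = 0 := by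
  obtain ⟨a, ha, rfl⟩ := exists_el x
  obtain ⟨b, hb, H⟩ := exIn_elim (allIn_elim h.field.2.2.2.2.2.2.2.1 ha)
  obtain ⟨c, hc, h₁, h₂⟩ := (h.ap₂_plus_iff ha hb).1 H
  exact ⟨h.el hb, h₁.trans (h.el_eq_el.2 h₂)⟩

noncomputable instance : Neg h.Q := ⟨fun x => (h.exists_neg x).choose⟩

protected theorem add_comm (x y : h.Q) : x + y = y + x := by
  obtain ⟨a, ha, rfl⟩ := exists_el x
  obtain ⟨b, hb, rfl⟩ := exists_el y
  obtain ⟨c, hc, h₁, h₂⟩ :=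
    (h.ap₂_plus_iff ha hb).1 (allIn_elim (allIn_elim h.field.2.2.2.2.2.1 ha) hb)
  obtain ⟨d, hd, h₃, h₄⟩ := (h.ap₂_plus_iff hb ha).1 h₂
  rw [h₁, h₃, h.el_eq_el.2 h₄]

protected theorem mul_comm (x y : h.Q) : x * y = y * x := by
  obtain ⟨a, ha, rfl⟩ := exists_el x
  obtain ⟨b, hb, rfl⟩ := exists_el y
  obtain ⟨c, hc, h₁, h₂⟩ := (h.ap₂_times_iff ha hb).1
    (allIn_elim (allIn_elim h.field.2.2.2.2.2.2.2.2.2.1 ha) hb)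
  obtain ⟨d, hd, h₃, h₄⟩ := (h.ap₂_times_iff hb ha).1 h₂
  rw [h₁, h₃, h.el_eq_el.2 h₄]

/-- The internal field axioms become identities of an actual ring, so that `abel` and
`linear_combination` apply to the reals of a world. -/
noncomputable instance : CommRing h.Q := CommRing.ofMinimalAxioms
  (by
    intro x y z
    obtain ⟨a, ha, rfl⟩ := exists_el x
    obtain ⟨b, hb, rfl⟩ := exists_el y
    obtain ⟨c, hc, rfl⟩ := exists_el z
    have H := allIn_elim (allIn_elim (allIn_elim h.field.2.2.2.2.1 ha) hb) hc
    obtain ⟨u, hu, h₁, H⟩ := (h.ap₂_plus_iff ha hb).1 H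
    obtain ⟨s, hs, h₂, H⟩ := (h.ap₂_plus_iff hu hc).1 H
    obtain ⟨v, hv, h₃, H⟩ := (h.ap₂_plus_iff hb hc).1 H
    obtain ⟨t, ht, h₄, H⟩ := (h.ap₂_plus_iff ha hv).1 H
    rw [h₁, h₂, h₃, h₄, h.el_eq_el.2 H])
  (by
    intro x
    obtain ⟨a, ha, rfl⟩ := exists_el x
    obtain ⟨s, hs, h₁, H⟩ :=
      (h.ap₂_plus_iff ha h.zero_mem).1 (allIn_elim h.field.2.2.2.2.2.2.1 ha)
    rw [h.add_comm, ← el_zero, h₁, h.el_eq_el.2 H])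
  (fun x => (h.add_comm _ _).trans (h.exists_neg x).choose_spec)
  (by
    intro x y z
    obtain ⟨a, ha, rfl⟩ := exists_el x
    obtain ⟨b, hb, rfl⟩ := exists_el y
    obtain ⟨c, hc, rfl⟩ := exists_el z
    have H := allIn_elim (allIn_elim (allIn_elim h.field.2.2.2.2.2.2.2.2.1 ha) hb) hc
    obtain ⟨u, hu, h₁, H⟩ := (h.ap₂_times_iff ha hb).1 H
    obtain ⟨s, hs, h₂, H⟩ := (h.ap₂_times_iff hu hc).1 H
    obtain ⟨v, hv, h₃, H⟩ := (h.ap₂_times_iff hb hc).1 H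
    obtain ⟨t, ht, h₄, H⟩ := (h.ap₂_times_iff ha hv).1 H
    rw [h₁, h₂, h₃, h₄, h.el_eq_el.2 H])
  h.mul_comm
  (by
    intro x
    obtain ⟨a, ha, rfl⟩ := exists_el x
    obtain ⟨s, hs, h₁, H⟩ :=
      (h.ap₂_times_iff ha h.one_mem).1 (allIn_elim h.field.2.2.2.2.2.2.2.2.2.2.1 ha)
    rw [h.mul_comm, ← el_one, h₁, h.el_eq_el.2 H])
  (by
    intro x y z
    obtain ⟨a, ha, rfl⟩ := exists_el x
    obtain ⟨b, hb, rfl⟩ := exists_el y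
    obtain ⟨c, hc, rfl⟩ := exists_el z
    have H := allIn_elim (allIn_elim (allIn_elim h.field.2.2.2.2.2.2.2.2.2.2.2.1 ha) hb) hc
    obtain ⟨u, hu, h₁, H⟩ := (h.ap₂_plus_iff hb hc).1 H
    obtain ⟨s, hs, h₂, H⟩ := (h.ap₂_times_iff ha hu).1 H
    obtain ⟨v, hv, h₃, H⟩ := (h.ap₂_times_iff ha hb).1 H
    obtain ⟨t, ht, h₄, H⟩ := (h.ap₂_times_iff ha hc).1 H
    obtain ⟨t', ht', h₅, H⟩ := (h.ap₂_plus_iff hv ht).1 H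
    rw [h₁, h₂, h₃, h₄, h₅, h.el_eq_el.2 H])

/-! ### The order -/

theorem avail_less (H : w ⊩ K.lt R a b) : Avail w.level R.less := avail_of_rel H

theorem lt_congr (ha : w ⊩ a =ₖ a') (hb : w ⊩ b =ₖ b') (H : w ⊩ K.lt R a b) :
    w ⊩ K.lt R a' b' :=
  rel_congr (eq_refl (avail_less H)) ha hb H

theorem le_congr (ha : w ⊩ a =ₖ a') (hb : w ⊩ b =ₖ b') (H : w ⊩ K.le R a b) :
    w ⊩ K.le R a' b' :=
  fun w' hw h' => H w' hw (lt_congr (eq_symm ((b =ₖ b').mono hw hb))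
    (eq_symm ((a =ₖ a').mono hw ha)) h')

/-- The strict order of the real numbers of `w` -/
def Lt (x y : h.Q) : Prop :=
  Quotient.liftOn₂ x y (fun a b => w ⊩ K.lt R a.1 b.1) fun _ _ _ _ ha hb =>
    propext ⟨lt_congr ha hb, lt_congr (eq_symm ha) (eq_symm hb)⟩

instance : LE h.Q :=
  ⟨fun x y => Quotient.liftOn₂ x y (fun a b => w ⊩ K.le R a.1 b.1) fun _ _ _ _ ha hb =>
    propext ⟨le_congr ha hb, le_congr (eq_symm ha) (eq_symm hb)⟩⟩

theorem el_lt_el {ha : w ⊩ a ∈ₖ R.car} {hb : w ⊩ b ∈ₖ R.car} :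
    h.Lt (h.el ha) (h.el hb) ↔ w ⊩ K.lt R a b := Iff.rfl

theorem el_le_el {ha : w ⊩ a ∈ₖ R.car} {hb : w ⊩ b ∈ₖ R.car} :
    h.el ha ≤ h.el hb ↔ w ⊩ K.le R a b := Iff.rfl

theorem pos_iff {ha : w ⊩ a ∈ₖ R.car} : h.Lt 0 (h.el ha) ↔ w ⊩ K.pos R a := Iff.rfl

variable {h} {x y z : h.Q}

theorem Lt.asymm (hxy : h.Lt x y) (hyx : h.Lt y x) : False := by
  obtain ⟨a, ha, rfl⟩ := exists_el x
  obtain ⟨b, hb, rfl⟩ := exists_el y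
  exact imp_elim (allIn_elim (allIn_elim h.ordered.2.1 ha) hb) ⟨hxy, hyx⟩

/-- A forced disjunction is a disjunction at the same world. Cotransitivity is therefore available
for genuine case distinctions and plays the part of trichotomy. -/
theorem Lt.cotrans (hxy : h.Lt x y) (z : h.Q) : h.Lt x z ∨ h.Lt z y := by
  obtain ⟨a, ha, rfl⟩ := exists_el x
  obtain ⟨b, hb, rfl⟩ := exists_el y
  obtain ⟨c, hc, rfl⟩ := exists_el z
  exact allIn_elim (imp_elim (allIn_elim (allIn_elim h.ordered.2.2.1 ha) hb) hxy) hc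

theorem Lt.trans (hxy : h.Lt x y) (hyz : h.Lt y z) : h.Lt x z :=
  (hxy.cotrans z).resolve_right fun hzy => hyz.asymm hzy

theorem Lt.not_le (hxy : h.Lt x y) (hyx : y ≤ x) : False := by
  obtain ⟨a, ha, rfl⟩ := exists_el x
  obtain ⟨b, hb, rfl⟩ := exists_el y
  exact imp_elim (w := w) hyx hxy

theorem Lt.trans_le (hxy : h.Lt x y) (hyz : y ≤ z) : h.Lt x z :=
  (hxy.cotrans z).resolve_right fun hzy => hzy.not_le hyz

/-- The relation ≤ is a forced negation, so the opposite strict inequality has to be refuted at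
every later world. -/
theorem Lt.le (hxy : h.Lt x y) : x ≤ y := by
  obtain ⟨a, ha, rfl⟩ := exists_el x
  obtain ⟨b, hb, rfl⟩ := exists_el y
  intro w' hw h'
  have hyx : (h.mono hw).Lt ((h.mono hw).el (Up.mono _ hw hb)) ((h.mono hw).el (Up.mono _ hw ha)) :=
    h'
  exact hyx.asymm (Up.mono _ hw hxy)

theorem Lt.add_right (hxy : h.Lt x y) (z : h.Q) : h.Lt (x + z) (y + z) := by
  obtain ⟨a, ha, rfl⟩ := exists_el x
  obtain ⟨b, hb, rfl⟩ := exists_el y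
  obtain ⟨c, hc, rfl⟩ := exists_el z
  have H := allIn_elim (imp_elim (allIn_elim (allIn_elim h.ordered.2.2.2.2.1 ha) hb) hxy) hc
  obtain ⟨s, hs, h₁, H⟩ := (h.ap₂_plus_iff ha hc).1 H
  obtain ⟨t, ht, h₂, H⟩ := (h.ap₂_plus_iff hb hc).1 H
  rw [h₁, h₂]
  exact H

theorem lt_mul_pos (hx : h.Lt 0 x) (hy : h.Lt 0 y) : h.Lt 0 (x * y) := by
  obtain ⟨a, ha, rfl⟩ := exists_el x
  obtain ⟨b, hb, rfl⟩ := exists_el y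
  have H := imp_elim (allIn_elim (imp_elim (allIn_elim h.ordered.2.2.2.2.2 ha) hx) hb) hy
  obtain ⟨s, hs, h₁, H⟩ := (h.ap₂_times_iff ha hb).1 H
  rw [h₁]
  exact H

theorem lt_zero_one : h.Lt 0 1 := h.ordered.1

theorem exists_inv (hx : h.Lt 0 x) : ∃ y, h.Lt 0 y ∧ x * y = 1 := by
  obtain ⟨a, ha, rfl⟩ := exists_el x
  obtain ⟨b, hb, H₁, H⟩ := exIn_elim
    (imp_elim (allIn_elim h.field.2.2.2.2.2.2.2.2.2.2.2.2 ha) hx)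
  obtain ⟨s, hs, h₁, H⟩ := (h.ap₂_times_iff ha hb).1 H
  exact ⟨h.el hb, H₁, h₁.trans (h.el_eq_el.2 H)⟩

/-- Antisymmetry is tightness, and transitivity is cotransitivity at a later world. The `<` that
this instance derives from ≤ is weaker than the forced strict order, which remains `Lt`. -/
noncomputable instance : PartialOrder h.Q where
  le_refl x := by
    obtain ⟨a, ha, rfl⟩ := exists_el x
    intro w' hw h'
    have : (h.mono hw).Lt ((h.mono hw).el (Up.mono _ hw ha)) ((h.mono hw).el (Up.mono _ hw ha)) :=
      h'
    exact this.asymm this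
  le_trans x y z hxy hyz := by
    obtain ⟨a, ha, rfl⟩ := exists_el x
    obtain ⟨b, hb, rfl⟩ := exists_el y
    obtain ⟨c, hc, rfl⟩ := exists_el z
    intro w' hw h'
    have H : (h.mono hw).Lt ((h.mono hw).el (Up.mono _ hw hc)) ((h.mono hw).el (Up.mono _ hw ha)) :=
      h'
    exact (H.cotrans ((h.mono hw).el (Up.mono _ hw hb))).elim (hyz w' hw) (hxy w' hw)
  le_antisymm x y hxy hyx := by
    obtain ⟨a, ha, rfl⟩ := exists_el x
    obtain ⟨b, hb, rfl⟩ := exists_el y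
    exact h.el_eq_el.2
      (imp_elim (imp_elim (allIn_elim (allIn_elim h.ordered.2.2.2.1 ha) hb) hxy) hyx)

instance : IsOrderedAddMonoid h.Q where
  add_le_add_left x y hxy z := by
    obtain ⟨a, ha, rfl⟩ := exists_el x
    obtain ⟨b, hb, rfl⟩ := exists_el y
    obtain ⟨c, hc, rfl⟩ := exists_el z
    obtain ⟨s, hs, h₁⟩ := exists_el (h.el ha + h.el hc)
    obtain ⟨t, ht, h₂⟩ := exists_el (h.el hb + h.el hc)
    rw [h₁, h₂]
    intro w' hw h'
    let k := h.mono hw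
    have e₁ := (k.add_eq_iff (Up.mono _ hw ha) (Up.mono _ hw hc) (Up.mono _ hw hs)).2
      (Up.mono _ hw ((h.add_eq_iff ha hc hs).1 h₁))
    have e₂ := (k.add_eq_iff (Up.mono _ hw hb) (Up.mono _ hw hc) (Up.mono _ hw ht)).2
      (Up.mono _ hw ((h.add_eq_iff hb hc ht).1 h₂))
    have H : k.Lt (k.el (Up.mono _ hw ht)) (k.el (Up.mono _ hw hs)) := h'
    have H' := H.add_right (-k.el (Up.mono _ hw hc))
    rw [← e₁, ← e₂, add_neg_cancel_right, add_neg_cancel_right] at H'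
    exact hxy w' hw H'

theorem lt_of_le_of_lt' (hxy : x ≤ y) (hyz : h.Lt y z) : h.Lt x z :=
  (hyz.cotrans x).resolve_left fun hyx => hyx.not_le hxy

theorem lt_iff_sub_pos : h.Lt x y ↔ h.Lt 0 (y - x) := by
  constructor
  · intro H
    have := H.add_right (-x)
    rwa [add_neg_cancel, ← sub_eq_add_neg] at this
  · intro H
    have := H.add_right x
    rwa [zero_add, sub_add_cancel] at this

theorem lt_add_pos (hx : h.Lt 0 x) (hy : h.Lt 0 y) : h.Lt 0 (x + y) := by
  have := hx.add_right y
  rw [zero_add] at this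
  exact hy.trans this

/-- There is a smaller positive number. -/
theorem exists_pos_lt (hx : h.Lt 0 x) : ∃ y, h.Lt 0 y ∧ h.Lt y x := by
  -- Here r = 1/2, the inverse of 1 + 1, and the smaller number is x/2.
  obtain ⟨r, hr, hr'⟩ := exists_inv (lt_add_pos (lt_zero_one (h := h)) lt_zero_one)
  refine ⟨x * r, lt_mul_pos hx hr, lt_iff_sub_pos.2 ?_⟩
  have : x - x * r = x * r := by linear_combination (-x) * hr'
  rw [this]
  exact lt_mul_pos hx hr

theorem exists_pos_lt_lt (hx : h.Lt 0 x) (hy : h.Lt 0 y) :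
    ∃ z, h.Lt 0 z ∧ h.Lt z x ∧ h.Lt z y := by
  obtain ⟨z, hz, hzx⟩ := exists_pos_lt hx
  rcases hzx.cotrans y with H | H
  · exact ⟨z, hz, hzx, H⟩
  · obtain ⟨z', hz', hzy⟩ := exists_pos_lt hy
    exact ⟨z', hz', hzy.trans H, hzy⟩

end RealsAt

/-! ### Maxima and absolute values -/

/-- `m = max(p, q)` -/
def RealVars.isMax (R : RealVars) (p q m : ℕ) : F :=
  R.le p m ⋏ R.le q m ⋏ allIn R.car fun s => R.le p s ⟹ R.le q s ⟹ R.le m s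

def K.isMax (R : RealVars) (p q m : ℕ) : Up :=
  K.le R p m ∧ₖ K.le R q m ∧ₖ K.allIn R.car fun s => K.le R p s →ₖ K.le R q s →ₖ K.le R m s

namespace RealsAt

variable {w : World} {R : RealVars} (h : RealsAt w R) {p q m : ℕ}

theorem exists_ge (x y : h.Q) : ∃ z, x ≤ z ∧ y ≤ z := by
  have hx : h.Lt x (x + 1) := lt_iff_sub_pos.2 (by rw [add_sub_cancel_left]; exact lt_zero_one)
  rcases hx.cotrans y with H | H
  · exact ⟨y, H.le, le_rfl⟩
  · exact ⟨x + 1, hx.le, H.le⟩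

/-- The maximum is the supremum of {p, q}. This set satisfies the constructive condition for a
supremum: for a < b, comparing p and q with a < b shows that one of them exceeds a or both are below
b. -/
theorem exists_max (h : RealsAt w R) (hp : w ⊩ p ∈ₖ R.car) (hq : w ⊩ q ∈ₖ R.car) :
    ∃ m, (w ⊩ m ∈ₖ R.car) ∧ w ⊩ K.isMax R p q m := by
  have hpa := avail_left_of_mem hp
  have hqa := avail_left_of_mem hq
  obtain ⟨S, hS, hpq⟩ := exists_upair hpa hqa
  have hpS : w ⊩ p ∈ₖ S := (mem_upair hpq).2 (Or.inl (eq_refl hpa))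
  have hqS : w ⊩ q ∈ₖ S := (mem_upair hpq).2 (Or.inr (eq_refl hqa))
  have le_of_mem : ∀ {w' : World}, w ≤ w' → ∀ {s b : ℕ}, Avail w'.level b → (w' ⊩ s ∈ₖ S) →
      (w' ⊩ K.le R p b) → (w' ⊩ K.le R q b) → w' ⊩ K.le R s b := by
    intro w' hw s b hb hs hpb hqb
    rcases (mem_upair (Up.mono _ hw hpq)).1 hs with hs | hs
    · exact le_congr (eq_symm hs) (eq_refl hb) hpb
    · exact le_congr (eq_symm hs) (eq_refl hb) hqb
  have hsub : w ⊩ K.isSubset S R.car := by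
    refine allIn_intro fun w' hw s hs => ?_
    have hR := eq_refl ((avail_right_of_mem hp).mono hw.1)
    rcases (mem_upair (Up.mono _ hw hpq)).1 hs with hs | hs
    · exact mem_congr (Up.mono _ hw hp) (eq_symm hs) hR
    · exact mem_congr (Up.mono _ hw hq) (eq_symm hs) hR
  have hbdd : w ⊩ K.exIn R.car fun b => K.allIn S fun s => K.le R s b := by
    obtain ⟨z, hpz, hqz⟩ := h.exists_ge (h.el hp) (h.el hq)
    obtain ⟨b, hb, rfl⟩ := exists_el z
    exact exIn_intro hb (allIn_intro fun w' hw s hs =>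
      le_of_mem hw ((avail_left_of_mem hb).mono hw.1) hs (Up.mono _ hw hpz) (Up.mono _ hw hqz))
  have hloc : w ⊩ K.allIn R.car fun a => K.allIn R.car fun b => K.lt R a b →ₖ
      (K.allIn S fun s => K.le R s b) ∨ₖ (K.exIn S fun s => K.lt R a s) := by
    refine allIn_intro fun w₁ hw₁ a ha => allIn_intro fun w₂ hw₂ b hb w₃ hw₃ hab => ?_
    have hw := (hw₁.trans hw₂).trans hw₃
    have k := h.mono hw
    have hab' : k.Lt (k.el (Up.mono _ (hw₂.trans hw₃) ha)) (k.el (Up.mono _ hw₃ hb)) := hab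
    rcases hab'.cotrans (k.el (Up.mono _ hw hp)) with H | H
    · exact Or.inr (exIn_intro (Up.mono _ hw hpS) H)
    rcases hab'.cotrans (k.el (Up.mono _ hw hq)) with H' | H'
    · exact Or.inr (exIn_intro (Up.mono _ hw hqS) H')
    · refine Or.inl (allIn_intro fun w₄ hw₄ s hs => le_of_mem (hw.trans hw₄)
        ((avail_left_of_mem hb).mono (hw₃.trans hw₄).1) hs ?_ ?_)
      · exact Up.mono _ hw₄ (k.el_le_el.1 H.le)
      · exact Up.mono _ hw₄ (k.el_le_el.1 H'.le)
  obtain ⟨m, hm, hub, hlub⟩ := exIn_elim (imp_elim (imp_elim (imp_elim (imp_elim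
    (all_elim h.complete hS) hsub) ⟨p, hpa, hpS⟩) hbdd) hloc)
  refine ⟨m, hm, allIn_elim (φ := fun s => K.le R s m) hub hpS,
    allIn_elim (φ := fun s => K.le R s m) hub hqS,
    allIn_intro fun w₁ hw₁ s hs w₂ hw₂ hps w₃ hw₃ hqs w₄ hw₄ hsm => ?_⟩
  have hw := ((hw₁.trans hw₂).trans hw₃).trans hw₄
  -- If an upper bound s were less than m, some member of {p, q} would exceed s.
  obtain ⟨s', hs', hss⟩ := exIn_elim (imp_elim (allIn_elim (Up.mono _ hw hlub)
    (Up.mono _ ((hw₂.trans hw₃).trans hw₄) hs)) hsm)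
  exact le_of_mem hw (avail_left_of_mem (Up.mono _ ((hw₂.trans hw₃).trans hw₄) hs)) hs'
    (Up.mono _ (hw₃.trans hw₄) hps) (Up.mono _ hw₄ hqs) w₄ le_rfl hss

theorem max_le {hp : w ⊩ p ∈ₖ R.car} {hq : w ⊩ q ∈ₖ R.car} {hm : w ⊩ m ∈ₖ R.car}
    (H : w ⊩ K.isMax R p q m) {x : h.Q} (hpx : h.el hp ≤ x) (hqx : h.el hq ≤ x) : h.el hm ≤ x := by
  obtain ⟨s, hs, rfl⟩ := exists_el x
  exact imp_elim (imp_elim (allIn_elim H.2.2 hs) hpx) hqx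

/-- `|x - y| ≤ η < ε`, given that `x ≤ y + η` and `y ≤ x + η` -/
theorem exists_abs_sub_lt {a b ε : ℕ} (ha : w ⊩ a ∈ₖ R.car) (hb : w ⊩ b ∈ₖ R.car)
    (hε : w ⊩ ε ∈ₖ R.car) {η : h.Q} (hab : h.el ha ≤ h.el hb + η) (hba : h.el hb ≤ h.el ha + η)
    (hη : h.Lt η (h.el hε)) :
    w ⊩ K.exIn R.car fun c => (K.ap₂ R.plus b c fun s => s =ₖ a) ∧ₖ
      K.exIn R.car fun t => K.isAbs R c t ∧ₖ K.lt R t ε := by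
  obtain ⟨c, hc, hc'⟩ := exists_el (h.el ha - h.el hb)
  obtain ⟨d, hd, hd'⟩ := exists_el (h.el hb - h.el ha)
  obtain ⟨t, ht, H⟩ := h.exists_max hc hd
  have hbc : h.el hb + h.el hc = h.el ha := by rw [← hc']; abel
  have hcd : h.el hc + h.el hd = h.el h.zero_mem := by rw [← hc', ← hd', el_zero]; abel
  have htη : h.el ht ≤ η := by
    refine h.max_le (hp := hc) (hq := hd) H ?_ ?_
    · rw [← hc']; exact sub_le_iff_le_add'.2 hab
    · rw [← hd']; exact sub_le_iff_le_add'.2 hba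
  -- The definition of |c| says exactly that it is the maximum of c and its negative d, so the
  -- maximum property `H` is reused as it stands.
  refine exIn_intro hc ⟨?_, exIn_intro ht ⟨exIn_intro hd ⟨?_, ht, H⟩, lt_of_le_of_lt' htη hη⟩⟩
  · exact (h.ap₂_plus_iff hb hc).2 ⟨a, ha, hbc, eq_refl (avail_left_of_mem ha)⟩
  · exact (h.ap₂_plus_iff hc hd).2
      ⟨R.zero, h.zero_mem, hcd, eq_refl (avail_left_of_mem h.zero_mem)⟩

end RealsAt

/-! ### Distances -/

section Metric

variable {w : World} {R : RealVars} {X : MetricVars} {Z : ℕ} {x y z a b c : ℕ}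

theorem dist_mem (hX : w ⊩ K.isMetric X R) (ha : Avail w.level a)
    (h : w ⊩ K.rel₂ X.dist x y a) : w ⊩ a ∈ₖ R.car :=
  rel₂_mem hX.1 ha h

theorem dist_symm (hX : w ⊩ K.isMetric X R) (hx : w ⊩ x ∈ₖ X.car) (hy : w ⊩ y ∈ₖ X.car)
    (ha : Avail w.level a) (hb : Avail w.level b)
    (h : w ⊩ K.rel₂ X.dist x y a) (h' : w ⊩ K.rel₂ X.dist y x b) : w ⊩ a =ₖ b := by
  obtain ⟨a', ha', h₁, H⟩ := ap₂_elim (allIn_elim (allIn_elim hX.2.2.2.1 hx) hy)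
  obtain ⟨b', hb', h₂, H⟩ := ap₂_elim H
  exact eq_trans (rel₂_unique hX.1 ha ha' h h₁) (eq_trans H (rel₂_unique hX.1 hb' hb h₂ h'))

theorem dist_self (hX : w ⊩ K.isMetric X R) (hx : w ⊩ x ∈ₖ X.car) :
    ∃ a, (w ⊩ K.rel₂ X.dist x x a) ∧ w ⊩ a =ₖ R.zero := by
  obtain ⟨a, ha, h₁, H⟩ := ap₂_elim (allIn_elim (allIn_elim hX.2.2.1 hx) hx)
  exact ⟨a, h₁, (iff_elim H).2 (eq_refl (avail_left_of_mem hx))⟩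

theorem dist_triangle (h : RealsAt w R) (hX : w ⊩ K.isMetric X R) (hx : w ⊩ x ∈ₖ X.car)
    (hy : w ⊩ y ∈ₖ X.car) (hz : w ⊩ z ∈ₖ X.car) (ha : w ⊩ a ∈ₖ R.car) (hb : w ⊩ b ∈ₖ R.car)
    (hc : w ⊩ c ∈ₖ R.car) (hxz : w ⊩ K.rel₂ X.dist x z a) (hxy : w ⊩ K.rel₂ X.dist x y b)
    (hyz : w ⊩ K.rel₂ X.dist y z c) : h.el ha ≤ h.el hb + h.el hc := by
  obtain ⟨a', ha', h₁, H⟩ := ap₂_elim (allIn_elim (allIn_elim (allIn_elim hX.2.2.2.2 hx) hy) hz)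
  obtain ⟨b', hb', h₂, H⟩ := ap₂_elim H
  obtain ⟨c', hc', h₃, H⟩ := ap₂_elim H
  have ha'' := dist_mem hX ha' h₁
  have hb'' := dist_mem hX hb' h₂
  have hc'' := dist_mem hX hc' h₃
  obtain ⟨s, hs, h₄, H⟩ := (h.ap₂_plus_iff hb'' hc'').1 H
  have e₁ := (h.el_eq_el (ha := ha) (hb := ha'')).2
    (rel₂_unique hX.1 (avail_left_of_mem ha) ha' hxz h₁)
  have e₂ := (h.el_eq_el (ha := hb) (hb := hb'')).2
    (rel₂_unique hX.1 (avail_left_of_mem hb) hb' hxy h₂)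
  have e₃ := (h.el_eq_el (ha := hc) (hb := hc'')).2
    (rel₂_unique hX.1 (avail_left_of_mem hc) hc' hyz h₃)
  rw [e₁, e₂, e₃, h₄]
  exact H

/-- `m = ρ(x, Z)` -/
abbrev K.infDist (R : RealVars) (X : MetricVars) (Z x m : ℕ) : Up :=
  K.isInf R Z m fun y => K.d X x y

theorem infDist_le (h : RealsAt w R) (hX : w ⊩ K.isMetric X R) {m : ℕ} (hm : w ⊩ m ∈ₖ R.car)
    (ha : w ⊩ a ∈ₖ R.car) (H : w ⊩ K.infDist R X Z x m) (hz : w ⊩ z ∈ₖ Z)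
    (hxz : w ⊩ K.rel₂ X.dist x z a) : h.el hm ≤ h.el ha := by
  obtain ⟨a', ha', h₁, H⟩ := ap₂_elim (allIn_elim H.2.1 hz)
  exact RealsAt.le_congr (eq_refl (avail_left_of_mem hm))
    (rel₂_unique hX.1 ha' (avail_left_of_mem ha) h₁ hxz) H

theorem exists_dist_lt (h : RealsAt w R) (hX : w ⊩ K.isMetric X R) {m : ℕ}
    (hm : w ⊩ m ∈ₖ R.car) (H : w ⊩ K.infDist R X Z x m) {e : h.Q} (he : h.Lt 0 e) :
    ∃ (z a : ℕ) (ha : w ⊩ a ∈ₖ R.car), (w ⊩ z ∈ₖ Z) ∧ (w ⊩ K.rel₂ X.dist x z a) ∧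
      h.Lt (h.el ha) (h.el hm + e) := by
  obtain ⟨e, he', rfl⟩ := RealsAt.exists_el e
  obtain ⟨z, hz, H⟩ := exIn_elim (imp_elim (allIn_elim H.2.2 he') he)
  obtain ⟨a, ha, h₁, H⟩ := ap₂_elim H
  obtain ⟨t, ht, h₂, H⟩ := (h.ap₂_plus_iff hm he').1 H
  refine ⟨z, a, dist_mem hX ha h₁, hz, h₁, ?_⟩
  rw [h₂]
  exact H

/-- The distance to Z is 1-Lipschitz. No infimum is attained, but ≤ is a negation, so it suffices to
refute m' + a < m at a later world. -/
theorem infDist_le_add (h : RealsAt w R) (hX : w ⊩ K.isMetric X R)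
    (hZ : w ⊩ K.isSubset Z X.car) {m m' : ℕ} (hx : w ⊩ x ∈ₖ X.car) (hy : w ⊩ y ∈ₖ X.car)
    (hm : w ⊩ m ∈ₖ R.car) (hm' : w ⊩ m' ∈ₖ R.car) (ha : w ⊩ a ∈ₖ R.car)
    (H : w ⊩ K.infDist R X Z x m) (H' : w ⊩ K.infDist R X Z y m')
    (hxy : w ⊩ K.rel₂ X.dist x y a) : h.el hm ≤ h.el hm' + h.el ha := by
  obtain ⟨s, hs, hs'⟩ := RealsAt.exists_el (h.el hm' + h.el ha)
  rw [hs']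
  intro w₁ hw hlt
  have k := h.mono hw
  have hmw := Up.mono _ hw hm
  have hmw' := Up.mono _ hw hm'
  have haw := Up.mono _ hw ha
  have hsw := Up.mono _ hw hs
  have hXw := Up.mono _ hw hX
  have hs'' : k.el hmw' + k.el haw = k.el hsw :=
    (k.add_eq_iff _ _ _).2 (Up.mono _ hw ((h.add_eq_iff _ _ _).1 hs'))
  have hlt' : k.Lt (k.el hsw) (k.el hmw) := hlt
  -- The tolerance is the supposed gap m - (m' + a). The point z then has ρ(x, z) ≤ a + ρ(y, z) < m,
  -- against the lower bound m.
  obtain ⟨z, b, hb, hz, hyz, hbm⟩ := exists_dist_lt k hXw hmw' (Up.mono _ hw H')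
    (RealsAt.lt_iff_sub_pos.1 hlt')
  have hzX := allIn_elim (Up.mono _ hw hZ) hz
  obtain ⟨c, hc, hxz⟩ := rel₂_total hXw.1 (Up.mono _ hw hx) hzX
  have h₁ := infDist_le k hXw hmw hc (Up.mono _ hw H) hz hxz
  have h₂ := dist_triangle k hXw (Up.mono _ hw hx) (Up.mono _ hw hy) hzX hc haw hb hxz
    (Up.mono _ hw hxy) hyz
  have h₃ := hbm.add_right (k.el haw)
  have h₄ : k.el hmw' + (k.el hmw - k.el hsw) + k.el haw = k.el hmw := by rw [← hs'']; abel
  rw [h₄, add_comm] at h₃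
  exact h₃.not_le (h₁.trans h₂)

end Metric

/-! ### The function `max(‖f(x)‖, ε - ρ(x, Z))` -/

/-- `m = max(‖f(x)‖, ε - ρ(x, Z))` -/
def gaugeVal (R : RealVars) (X : MetricVars) (norm f Z ε x m : ℕ) : F :=
  ap f x fun y => ap norm y fun p => ex fun d => (R.isInf Z d fun z => X.d x z) ⋏
    exIn R.car fun q => (ap₂ R.plus q d fun s => s ≐ ε) ⋏ R.isMax p q m

def K.gaugeVal (R : RealVars) (X : MetricVars) (norm f Z ε x m : ℕ) : Up :=
  K.ap f x fun y => K.ap norm y fun p => K.ex fun d => K.infDist R X Z x d ∧ₖ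
    K.exIn R.car fun q => (K.ap₂ R.plus q d fun s => s =ₖ ε) ∧ₖ K.isMax R p q m

/-- `y` is an element `(x, m)` of the graph of `x ↦ max(‖f(x)‖, ε - ρ(x, Z))`. -/
def gaugeGraph (R : RealVars) (X : MetricVars) (norm f Z ε x y : ℕ) : F :=
  exIn R.car fun m => isPair y x m ⋏ gaugeVal R X norm f Z ε x m

def K.gaugeGraph (R : RealVars) (X : MetricVars) (norm f Z ε x y : ℕ) : Up :=
  K.exIn R.car fun m => K.isPair y x m ∧ₖ K.gaugeVal R X norm f Z ε x m

/-- The assignment of the parameters of `gaugeVal` -/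
def gaugeEnv (R : RealVars) (X : MetricVars) (norm f Z ε : ℕ) : ℕ → ℕ :=
  cons ε <| cons Z <| cons f <| cons norm <| cons X.dist <| cons X.car <|
    cons R.zero <| cons R.less <| cons R.plus fun _ => R.car

/-- At depth 12 the level name l is the index 11 - l, so 0, …, 9 name the parameters of `gaugeEnv`
in reverse, and 11 and 10 name x and y. Products and the unit do not occur in the formula, so their
slots hold the dummy name 0. -/
theorem sat_gaugeGraph (R : RealVars) (X : MetricVars) (norm f Z ε x y : ℕ) :
    sat (gaugeGraph ⟨0, 1, 0, 2, 3, 0⟩ ⟨4, 5⟩ 6 7 8 9 11 10 12)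
      (cons x (cons y (gaugeEnv R X norm f Z ε))) = K.gaugeGraph R X norm f Z ε x y := rfl

theorem sat_gaugeVal (R : RealVars) (X : MetricVars) (norm f Z ε x m : ℕ) :
    sat (gaugeVal ⟨0, 1, 0, 2, 3, 0⟩ ⟨4, 5⟩ 6 7 8 9 11 10 12)
      (cons x (cons m (gaugeEnv R X norm f Z ε))) = K.gaugeVal R X norm f Z ε x m := rfl

/-- The hypotheses, in the world `w`: a map `f` from a metric space to a normed space, and a located
set `Z` -/
structure Setting (w : World) (R : RealVars) (X : MetricVars) (Y : NormedVars) (f Z : ℕ) : Prop where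
  reals : RealsAt w R
  metric : w ⊩ K.isMetric X R
  norm : w ⊩ K.isFun Y.norm Y.car R.car
  norm_add : w ⊩ (K.allIn Y.car fun x => K.allIn Y.car fun y => K.ap₂ Y.sum x y fun z =>
    K.ap Y.norm z fun c => K.ap Y.norm x fun a => K.ap Y.norm y fun b =>
      K.ap₂ R.plus a b fun s => K.le R c s)
  map : w ⊩ K.isFun f X.car Y.car
  subset : w ⊩ K.isSubset Z X.car
  located : w ⊩ K.isLocated X R Z
  cont : w ⊩ K.isUniformlyContinuous R X Y f
  sum : w ⊩ K.isFun₂ Y.sum Y.car Y.car Y.car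
  inhabited : w ⊩ K.ex fun z => z ∈ₖ Z

/-! ### The gauge as a function, and its continuity estimate -/

namespace Setting

variable {w w' : World} {R : RealVars} {X : MetricVars} {Y : NormedVars} {f Z : ℕ}

theorem mono (S : Setting w R X Y f Z) (hw : w ≤ w') : Setting w' R X Y f Z :=
  ⟨S.reals.mono hw, Up.mono _ hw S.metric, Up.mono _ hw S.norm, Up.mono _ hw S.norm_add,
    Up.mono _ hw S.map, Up.mono _ hw S.subset, Up.mono _ hw S.located, Up.mono _ hw S.cont,
    Up.mono _ hw S.sum, Up.mono _ hw S.inhabited⟩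

variable (S : Setting w R X Y f Z) {ε x x' m m' a : ℕ}

theorem gaugeVal_elim (S : Setting w R X Y f Z) (hε : w ⊩ ε ∈ₖ R.car)
    (H : w ⊩ K.gaugeVal R X Y.norm f Z ε x m) :
    ∃ (y p d q : ℕ) (_ : w ⊩ p ∈ₖ R.car) (hd : w ⊩ d ∈ₖ R.car) (hq : w ⊩ q ∈ₖ R.car),
      Avail w.level y ∧ (w ⊩ K.rel f x y) ∧ (w ⊩ K.rel Y.norm y p) ∧ (w ⊩ K.infDist R X Z x d) ∧
      S.reals.el hq + S.reals.el hd = S.reals.el hε ∧ w ⊩ K.isMax R p q m := by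
  obtain ⟨y, hy, hxy, H⟩ := ap_elim H
  obtain ⟨p, hp, hyp, d, -, hinf, H⟩ := ap_elim H
  obtain ⟨q, hq, H, hmax⟩ := exIn_elim H
  obtain ⟨s, hs, h₁, h₂⟩ := (S.reals.ap₂_plus_iff hq hinf.1).1 H
  exact ⟨y, p, d, q, (rel_mem S.norm hy hp hyp).2, hinf.1, hq, hy, hxy, hyp, hinf,
    h₁.trans (S.reals.el_eq_el.2 h₂), hmax⟩

theorem exists_gaugeVal (S : Setting w R X Y f Z) (hε : w ⊩ ε ∈ₖ R.car) (hx : w ⊩ x ∈ₖ X.car) :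
    ∃ m, (w ⊩ m ∈ₖ R.car) ∧ w ⊩ K.gaugeVal R X Y.norm f Z ε x m := by
  obtain ⟨y, hy, hxy⟩ := rel_total S.map hx
  obtain ⟨p, hp, hyp⟩ := rel_total S.norm hy
  obtain ⟨d, hd, hinf⟩ := allIn_elim S.located hx
  obtain ⟨q, hq, hq'⟩ := RealsAt.exists_el (S.reals.el hε - S.reals.el hinf.1)
  obtain ⟨m, hm, hmax⟩ := S.reals.exists_max hp hq
  refine ⟨m, hm, y, avail_left_of_mem hy, hxy, p, avail_left_of_mem hp, hyp, d, hd, hinf,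
    exIn_intro hq ⟨(S.reals.ap₂_plus_iff hq hinf.1).2 ⟨ε, hε, ?_, ?_⟩, hmax⟩⟩
  · rw [← hq', sub_add_cancel]
  · exact eq_refl (avail_left_of_mem hε)

/-- The gauge function is as uniformly continuous as `‖f(x)‖` and `ρ(x, Z)`. -/
theorem gaugeVal_le_add (hε : w ⊩ ε ∈ₖ R.car) (hx : w ⊩ x ∈ₖ X.car) (hx' : w ⊩ x' ∈ₖ X.car)
    (hm : w ⊩ m ∈ₖ R.car) (hm' : w ⊩ m' ∈ₖ R.car) (ha : w ⊩ a ∈ₖ R.car)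
    (H : w ⊩ K.gaugeVal R X Y.norm f Z ε x m) (H' : w ⊩ K.gaugeVal R X Y.norm f Z ε x' m')
    (hdist : w ⊩ K.rel₂ X.dist x' x a) {η : S.reals.Q} (haη : S.reals.el ha ≤ η)
    (hnorm : ∀ (y y' p p' : ℕ) (hp : w ⊩ p ∈ₖ R.car) (hp' : w ⊩ p' ∈ₖ R.car), Avail w.level y →
      Avail w.level y' → (w ⊩ K.rel f x y) → (w ⊩ K.rel f x' y') → (w ⊩ K.rel Y.norm y p) →
      (w ⊩ K.rel Y.norm y' p') → S.reals.el hp ≤ S.reals.el hp' + η) :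
    S.reals.el hm ≤ S.reals.el hm' + η := by
  obtain ⟨y, p, d, q, hp, hd, hq, hy, hxy, hyp, hinf, hqd, hmax⟩ := S.gaugeVal_elim hε H
  obtain ⟨y', p', d', q', hp', hd', hq', hy', hxy', hyp', hinf', hqd', hmax'⟩ :=
    S.gaugeVal_elim hε H'
  have hpm : S.reals.el hp' ≤ S.reals.el hm' := hmax'.1
  have hqm : S.reals.el hq' ≤ S.reals.el hm' := hmax'.2.1
  -- It suffices to bound both terms of the maximum. For ε - ρ(x, Z) this is the Lipschitz bound
  -- with the two points exchanged, because the distance enters with a minus sign.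
  refine S.reals.max_le (hp := hp) (hq := hq) hmax ?_ ?_
  · exact (hnorm y y' p p' hp hp' hy hy' hxy hxy' hyp hyp').trans (add_le_add_left hpm _)
  · have h₁ := infDist_le_add S.reals S.metric S.subset hx' hx hd' hd ha hinf' hinf hdist
    have h₂ : S.reals.el hd' ≤ S.reals.el hd + η := h₁.trans (add_le_add_right haη _)
    have h₃ : S.reals.el hq ≤ S.reals.el hq' + η := by
      rw [eq_sub_of_add_eq hqd, eq_sub_of_add_eq hqd', sub_add_eq_add_sub]
      rw [sub_le_iff_le_add, sub_add_eq_add_sub, le_sub_iff_add_le, add_assoc]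
      exact add_le_add_right (h₂.trans_eq (add_comm _ _)) _
    exact h₃.trans (add_le_add_left hqm _)

theorem gaugeVal_unique (S : Setting w R X Y f Z) (hε : w ⊩ ε ∈ₖ R.car) (hx : w ⊩ x ∈ₖ X.car)
    (hm : w ⊩ m ∈ₖ R.car) (hm' : w ⊩ m' ∈ₖ R.car) (H : w ⊩ K.gaugeVal R X Y.norm f Z ε x m)
    (H' : w ⊩ K.gaugeVal R X Y.norm f Z ε x m') : w ⊩ m =ₖ m' := by
  obtain ⟨a, ha, ha'⟩ := dist_self S.metric hx
  have haR := dist_mem S.metric (avail_left_of_eq ha') ha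
  have ha₀ : S.reals.el haR = 0 := S.reals.el_eq_el.2 ha'
  have key : ∀ {m m' : ℕ} (hm : w ⊩ m ∈ₖ R.car) (hm' : w ⊩ m' ∈ₖ R.car),
      (w ⊩ K.gaugeVal R X Y.norm f Z ε x m) → (w ⊩ K.gaugeVal R X Y.norm f Z ε x m') →
      S.reals.el hm ≤ S.reals.el hm' := by
    intro m m' hm hm' H H'
    -- Uniqueness is the continuity estimate for x against itself, with error 0.
    have := S.gaugeVal_le_add hε hx hx hm hm' haR H H' ha (η := 0) ha₀.le ?_
    · rwa [add_zero] at this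
    intro y y' p p' hp hp' hy hy' hxy hxy' hyp hyp'
    have hyy := rel_unique S.map (avail_left_of_mem hx) hy hy' hxy hxy'
    have hpp := rel_unique S.norm hy' (avail_left_of_mem hp) (avail_left_of_mem hp')
      (rel_congr (eq_refl (avail_of_rel hyp)) hyy (eq_refl (avail_left_of_mem hp)) hyp) hyp'
    rw [add_zero]
    exact (S.reals.el_eq_el.2 hpp).le
  exact S.reals.el_eq_el.1 (le_antisymm (key hm hm' H H') (key hm' hm H' H))

/-- A name occurring in a formula of a world is available there. A point of Z provides instances in
which the maps, carriers and operations occur. -/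
theorem gaugeEnv_avail (S : Setting w R X Y f Z) (hε : w ⊩ ε ∈ₖ R.car) :
    ∀ i, Avail w.level (gaugeEnv R X Y.norm f Z ε i) := by
  obtain ⟨z, -, hz⟩ := S.inhabited
  have hx := allIn_elim S.subset hz
  obtain ⟨y, hy, hxy⟩ := rel_total S.map hx
  obtain ⟨p, hp, hyp⟩ := rel_total S.norm hy
  obtain ⟨a, ha, -⟩ := dist_self S.metric hx
  obtain ⟨s, hs, hps⟩ := rel₂_total S.reals.plus_fun hp hp
  rintro (_ | _ | _ | _ | _ | _ | _ | _ | _ | i)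
  exacts [avail_left_of_mem hε, avail_right_of_mem hz, avail_of_rel hxy, avail_of_rel hyp,
    avail_of_rel₂ ha, avail_right_of_mem hx, avail_left_of_mem S.reals.zero_mem,
    RealsAt.avail_less S.reals.ordered.1, avail_of_rel₂ hps, avail_right_of_mem hp]

theorem gaugeVal_congr (S : Setting w R X Y f Z) (hε : w ⊩ ε ∈ₖ R.car) (hx : w ⊩ x =ₖ x')
    (hm : w ⊩ m =ₖ m') (H : w ⊩ K.gaugeVal R X Y.norm f Z ε x m) :
    w ⊩ K.gaugeVal R X Y.norm f Z ε x' m' := by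
  rw [← sat_gaugeVal] at H ⊢
  refine sat_congr _ ?_ H
  rintro (_ | _ | i)
  exacts [hx, hm, eq_refl (S.gaugeEnv_avail hε i)]

/-- The function `g(x) = max(‖f(x)‖, ε - ρ(x, Z))` exists as a set. -/
theorem exists_gauge (S : Setting w R X Y f Z) (hε : w ⊩ ε ∈ₖ R.car) :
    ∃ g, Avail w.level g ∧ (w ⊩ K.isFun g X.car R.car) ∧
      ∀ w', w ≤ w' → ∀ x m, Avail w'.level x → Avail w'.level m → (w' ⊩ K.rel g x m) →
        (w' ⊩ x ∈ₖ X.car) ∧ (w' ⊩ m ∈ₖ R.car) ∧ w' ⊩ K.gaugeVal R X Y.norm f Z ε x m := by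
  have he := S.gaugeEnv_avail hε
  have htot : w ⊩ K.allIn X.car fun x => K.ex fun y => K.gaugeGraph R X Y.norm f Z ε x y := by
    refine allIn_intro fun w' hw x hx => ?_
    obtain ⟨m, hm, H⟩ := (S.mono hw).exists_gaugeVal (Up.mono _ hw hε) hx
    obtain ⟨y, hy, hp⟩ := exists_pair (avail_left_of_mem hx) (avail_left_of_mem hm)
    exact ⟨y, hy, exIn_intro hm ⟨hp, H⟩⟩
  -- Collection is applied to pairs (x, m) rather than to values m, so the collected set is itself
  -- the graph. Its second half excludes foreign elements, so no separation is needed for the gauge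
  -- formula, whose quantifiers are not all bounded.
  obtain ⟨g, hg, h₁, h₂⟩ := strongCollection_elim
    (gaugeGraph ⟨0, 1, 0, 2, 3, 0⟩ ⟨4, 5⟩ 6 7 8 9 11 10 12) he (he 5) htot
  simp only [sat_gaugeGraph] at h₁ h₂
  have key : ∀ w', w ≤ w' → ∀ x m, Avail w'.level x → Avail w'.level m → (w' ⊩ K.rel g x m) →
        (w' ⊩ x ∈ₖ X.car) ∧ (w' ⊩ m ∈ₖ R.car) ∧ w' ⊩ K.gaugeVal R X Y.norm f Z ε x m := by
    intro w' hw x m hx hm ⟨p, _, hp, hpg⟩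
    obtain ⟨x', hx', H⟩ := exIn_elim (allIn_elim (Up.mono _ hw h₂) hpg)
    obtain ⟨m', hm', hp', H⟩ := exIn_elim H
    obtain ⟨exx, emm⟩ := pair_injective hx hm (avail_left_of_mem hx') (avail_left_of_mem hm') hp hp'
    exact ⟨mem_congr hx' (eq_symm exx) (eq_refl (avail_right_of_mem hx')),
      mem_congr hm' (eq_symm emm) (eq_refl (avail_right_of_mem hm')),
      (S.mono hw).gaugeVal_congr (Up.mono _ hw hε) (eq_symm exx) (eq_symm emm) H⟩
  refine ⟨g, hg, ⟨?_, ?_, ?_⟩, key⟩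
  · refine allIn_intro fun w' hw p hpg => ?_
    obtain ⟨x, hx, H⟩ := exIn_elim (allIn_elim (Up.mono _ hw h₂) hpg)
    obtain ⟨m, hm, hp, -⟩ := exIn_elim H
    exact exIn_intro hx (exIn_intro hm hp)
  · refine allIn_intro fun w' hw x hx => ?_
    obtain ⟨p, hpg, H⟩ := exIn_elim (allIn_elim (Up.mono _ hw h₁) hx)
    obtain ⟨m, hm, hp, -⟩ := exIn_elim H
    exact exIn_intro hm ⟨p, avail_left_of_mem hpg, hp, hpg⟩
  · intro w₁ hw₁ x hx w₂ hw₂ m hm w₃ hw₃ m' hm' w₄ hw₄ H w₅ hw₅ H'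
    have hw : w ≤ w₅ := by order
    have hx := hx.mono (show w₁ ≤ w₅ by order).1
    have hm := hm.mono (show w₂ ≤ w₅ by order).1
    have hm' := hm'.mono (show w₃ ≤ w₅ by order).1
    obtain ⟨hxX, hmR, H⟩ := key w₅ hw x m hx hm (Up.mono _ hw₅ H)
    obtain ⟨-, hmR', H'⟩ := key w₅ hw x m' hx hm' H'
    exact (S.mono hw).gaugeVal_unique (Up.mono _ hw hε) hxX hmR hmR' H H'

/-- `‖u‖ ≤ ‖v‖ + ‖c‖` if `v + c = u` -/
theorem norm_le_add (S : Setting w R X Y f Z) {u v c p q r : ℕ} (hv : w ⊩ v ∈ₖ Y.car)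
    (hc : w ⊩ c ∈ₖ Y.car) (hu : Avail w.level u) (hp : w ⊩ p ∈ₖ R.car) (hq : w ⊩ q ∈ₖ R.car)
    (hr : w ⊩ r ∈ₖ R.car) (hsum : w ⊩ K.rel₂ Y.sum v c u) (hup : w ⊩ K.rel Y.norm u p)
    (hvq : w ⊩ K.rel Y.norm v q) (hcr : w ⊩ K.rel Y.norm c r) :
    S.reals.el hp ≤ S.reals.el hq + S.reals.el hr := by
  obtain ⟨z, hz, h₁, H⟩ := ap₂_elim (allIn_elim (allIn_elim S.norm_add hv) hc)
  obtain ⟨p', hp', h₂, H⟩ := ap_elim H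
  obtain ⟨q', hq', h₃, H⟩ := ap_elim H
  obtain ⟨r', hr', h₄, H⟩ := ap_elim H
  have hzu := rel₂_unique S.sum hz hu h₁ hsum
  have hN := eq_refl (avail_of_rel hup)
  have ep := rel_unique S.norm hu (avail_left_of_mem hp) hp' hup
    (rel_congr hN hzu (eq_refl hp') h₂)
  have eq' := rel_unique S.norm (avail_left_of_mem hv) (avail_left_of_mem hq) hq' hvq h₃
  have er := rel_unique S.norm (avail_left_of_mem hc) (avail_left_of_mem hr) hr' hcr h₄
  have hR := eq_refl (avail_right_of_mem hp)
  rw [(S.reals.el_eq_el (hb := mem_congr hp ep hR)).2 ep,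
    (S.reals.el_eq_el (hb := mem_congr hq eq' hR)).2 eq',
    (S.reals.el_eq_el (hb := mem_congr hr er hR)).2 er]
  obtain ⟨s, hs, h₅, H⟩ := (S.reals.ap₂_plus_iff _ _).1 H
  rw [h₅]
  exact H

end Setting

/-! ### Uniform continuity and positivity of the gauge, and the conclusion -/

namespace Setting

variable {w w' : World} {R : RealVars} {X : MetricVars} {Y : NormedVars} {f Z : ℕ}
  (S : Setting w R X Y f Z) {ε g x x' m p a δ η : ℕ}

/-- The inequality `‖f(x)‖ ≤ ‖f(x')‖ + η` for points at distance less than `δ` -/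
theorem norm_le_add_of_dist_lt (hη : w ⊩ η ∈ₖ R.car)
    (H : w ⊩ K.allIn X.car fun x => K.allIn X.car fun x' => (K.d X x x' fun a => K.lt R a δ) →ₖ
      K.ap f x fun u => K.ap f x' fun v => K.exIn Y.car fun c =>
        (K.ap₂ Y.sum v c fun s => s =ₖ u) ∧ₖ K.ap Y.norm c fun r => K.lt R r η)
    (hx : w ⊩ x ∈ₖ X.car) (hx' : w ⊩ x' ∈ₖ X.car) (ha : Avail w.level a)
    (hxx : w ⊩ K.rel₂ X.dist x x' a) (haδ : w ⊩ K.lt R a δ)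
    (y y' p p' : ℕ) (hp : w ⊩ p ∈ₖ R.car) (hp' : w ⊩ p' ∈ₖ R.car) (hy : Avail w.level y)
    (hy' : Avail w.level y') (hxy : w ⊩ K.rel f x y) (hxy' : w ⊩ K.rel f x' y')
    (hyp : w ⊩ K.rel Y.norm y p) (hyp' : w ⊩ K.rel Y.norm y' p') :
    S.reals.el hp ≤ S.reals.el hp' + S.reals.el hη := by
  obtain ⟨u, hu, hxu, H⟩ := ap_elim (imp_elim (allIn_elim (allIn_elim H hx) hx')
    (ap₂_intro ha hxx haδ))
  obtain ⟨v, hv, hxv, H⟩ := ap_elim H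
  obtain ⟨c, hc, hsum, H⟩ := exIn_elim H
  obtain ⟨r, hr, hcr, hrη⟩ := ap_elim H
  obtain ⟨s, hs, hvc, hsu⟩ := ap₂_elim hsum
  have eu := rel_unique S.map (avail_left_of_mem hx) hy hu hxy hxu
  have ev := rel_unique S.map (avail_left_of_mem hx') hy' hv hxy' hxv
  have hsy := eq_trans hsu (eq_symm eu)
  have hr' := (rel_mem S.norm (avail_left_of_mem hc) hr hcr).2
  have hvY := (rel_mem S.map (avail_left_of_mem hx') hv hxv).2
  have hN := eq_refl (avail_of_rel hyp)
  have := S.norm_le_add hvY hc hy hp hp' hr'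
    (rel₂_congr (avail_of_rel₂ hvc) (eq_refl hv) (eq_refl (avail_left_of_mem hc)) hsy hvc) hyp
    (rel_congr hN ev (eq_refl (avail_left_of_mem hp')) hyp') hcr
  have hrη' : S.reals.Lt (S.reals.el hr') (S.reals.el hη) := hrη
  exact this.trans (add_le_add_right hrη'.le _)

/-- `g` is the function `x ↦ max(‖f(x)‖, ε - ρ(x, Z))`. -/
def IsGauge (w : World) (R : RealVars) (X : MetricVars) (Y : NormedVars) (f Z ε g : ℕ) : Prop :=
  (w ⊩ K.isFun g X.car R.car) ∧
    ∀ w', w ≤ w' → ∀ x m, Avail w'.level x → Avail w'.level m → (w' ⊩ K.rel g x m) →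
      (w' ⊩ x ∈ₖ X.car) ∧ (w' ⊩ m ∈ₖ R.car) ∧ w' ⊩ K.gaugeVal R X Y.norm f Z ε x m

theorem gauge_uniformlyContinuous (S : Setting w R X Y f Z) (hε : w ⊩ ε ∈ₖ R.car)
    (hg : IsGauge w R X Y f Z ε g) : w ⊩ K.isUniformlyContinuousReal X R g := by
  refine allIn_intro fun w₁ hw₁ e he w₂ hw₂ hepos => ?_
  have hw₀₂ := hw₁.trans hw₂
  have S₂ := S.mono hw₀₂
  have he₂ := Up.mono _ hw₂ he
  -- The estimates only give |g(x) - g(y)| ≤ η, so η is taken strictly below the required bound.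
  obtain ⟨η, hη, hηe⟩ := RealsAt.exists_pos_lt (S₂.reals.pos_iff (ha := he₂) |>.2 hepos)
  obtain ⟨η, hηR, rfl⟩ := RealsAt.exists_el η
  obtain ⟨δ', hδ', hδ'pos, hcont⟩ := exIn_elim (imp_elim (allIn_elim S₂.cont hηR) hη)
  obtain ⟨δ, hδpos, hδδ', hδη⟩ :=
    -- Below δ' for the variation of ‖f‖, and below η for that of the distance to Z.
    RealsAt.exists_pos_lt_lt (S₂.reals.pos_iff (ha := hδ') |>.2 hδ'pos) hη
  obtain ⟨δ, hδ, rfl⟩ := RealsAt.exists_el δ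
  refine exIn_intro hδ ⟨hδpos, allIn_intro fun w₃ hw₃ x hx => allIn_intro fun w₄ hw₄ y hy w₅ hw₅
    H => ?_⟩
  have hw₂₅ : w₂ ≤ w₅ := by order
  have hw₀₅ : w ≤ w₅ := by order
  have T := S₂.mono hw₂₅
  have hx := Up.mono _ (show w₃ ≤ w₅ by order) hx
  have hy := Up.mono _ hw₅ hy
  have hε := Up.mono _ hw₀₅ hε
  have hη := Up.mono _ hw₂₅ hηR
  have he := Up.mono _ hw₂₅ he₂
  obtain ⟨a, ha, hxy, haδ⟩ := ap₂_elim H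
  have haR := dist_mem T.metric ha hxy
  have haδ₁ : T.reals.Lt (T.reals.el haR) (T.reals.el (Up.mono _ hw₂₅ hδ)) := haδ
  have hδη₁ : T.reals.Lt (T.reals.el (Up.mono _ hw₂₅ hδ)) (T.reals.el hη) := Up.mono _ hw₂₅ hδη
  have hδδ₁ : T.reals.Lt (T.reals.el (Up.mono _ hw₂₅ hδ)) (T.reals.el (Up.mono _ hw₂₅ hδ')) :=
    Up.mono _ hw₂₅ hδδ'
  have hηe₁ : T.reals.Lt (T.reals.el hη) (T.reals.el he) := Up.mono _ hw₂₅ hηe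
  obtain ⟨b, hb, hyx⟩ := rel₂_total T.metric.1 hy hx
  have hab : T.reals.el haR = T.reals.el hb := T.reals.el_eq_el.2
    (dist_symm T.metric hx hy ha (avail_left_of_mem hb) hxy hyx)
  have hg₁ := Up.mono _ hw₀₅ hg.1
  obtain ⟨u, hu, hxu⟩ := rel_total hg₁ hx
  obtain ⟨v, hv, hyv⟩ := rel_total hg₁ hy
  have hxa := avail_left_of_mem hx
  have hya := avail_left_of_mem hy
  have hua := avail_left_of_mem hu
  have hva := avail_left_of_mem hv
  obtain ⟨-, -, hxval⟩ := hg.2 w₅ hw₀₅ x u hxa hua hxu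
  obtain ⟨-, -, hyval⟩ := hg.2 w₅ hw₀₅ y v hya hva hyv
  have hcont := Up.mono _ hw₂₅ hcont
  refine ⟨u, hua, hxu, v, hva, hyv, ?_⟩
  refine T.reals.exists_abs_sub_lt hu hv he (η := T.reals.el hη) ?_ ?_ hηe₁
  · exact T.gaugeVal_le_add hε hx hy hu hv hb hxval hyval hyx
      (hab ▸ (haδ₁.trans hδη₁).le)
      (T.norm_le_add_of_dist_lt hη hcont hx hy ha hxy (haδ₁.trans hδδ₁))
  · exact T.gaugeVal_le_add hε hy hx hv hu haR hyval hxval hxy (haδ₁.trans hδη₁).le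
      (T.norm_le_add_of_dist_lt hη hcont hy hx (avail_left_of_mem hb) hyx
        (T.reals.el_lt_el.1 (hab ▸ haδ₁.trans hδδ₁)))

/-- If `‖f(x)‖ < δ` implies `ρ(x, Z) < ε` for some `δ > 0`, then `max(‖f(x)‖, ε - ρ(x, Z)) > 0`. -/
theorem gaugeVal_pos (S : Setting w R X Y f Z) (hε : w ⊩ ε ∈ₖ R.car) (hεpos : w ⊩ K.pos R ε)
    (hm : w ⊩ m ∈ₖ R.car) (hst : w ⊩ K.isZStableAt R X Y f Z x)
    (H : w ⊩ K.gaugeVal R X Y.norm f Z ε x m) : w ⊩ K.pos R m := by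
  obtain ⟨δ, hδ, hδpos, hst⟩ := exIn_elim (imp_elim (allIn_elim hst hε) hεpos)
  obtain ⟨y, p, d, q, hp, hd, hq, hy, hxy, hyp, hinf, hqd, hmax⟩ := S.gaugeVal_elim hε H
  have hpm : S.reals.el hp ≤ S.reals.el hm := hmax.1
  have hqm : S.reals.el hq ≤ S.reals.el hm := hmax.2.1
  rw [← S.reals.pos_iff (ha := hm)]
  rcases (S.reals.pos_iff (ha := hδ) |>.2 hδpos).cotrans (S.reals.el hp) with hpos | hlt
  · exact hpos.trans_le hpm
  · obtain ⟨z, hz, hnear⟩ := exIn_elim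
      (imp_elim hst ⟨y, hy, hxy, p, avail_left_of_mem hp, hyp, hlt⟩)
    obtain ⟨a, ha, hxz, haε⟩ := ap₂_elim hnear
    have haR := dist_mem S.metric ha hxz
    have haε : S.reals.Lt (S.reals.el haR) (S.reals.el hε) := haε
    have hda := infDist_le S.reals S.metric hd haR hinf hz hxz
    have hdε := RealsAt.lt_iff_sub_pos.1 (RealsAt.lt_of_le_of_lt' hda haε)
    rw [← hqd, add_sub_cancel_right] at hdε
    exact hdε.trans_le hqm

/-- If `‖f(x)‖ < δ < M ≤ max(‖f(x)‖, ε - ρ(x, Z))`, then `ρ(x, Z) < ε`. -/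
theorem near_of_gaugeVal (hε : w ⊩ ε ∈ₖ R.car) (hm : w ⊩ m ∈ₖ R.car) (hδ : w ⊩ δ ∈ₖ R.car)
    (hδpos : w ⊩ K.pos R δ) (hδm : S.reals.Lt (S.reals.el hδ) (S.reals.el hm))
    (hx : w ⊩ x ∈ₖ X.car) (H : w ⊩ K.gaugeVal R X Y.norm f Z ε x m)
    (hlt : w ⊩ K.normLt R Y f x δ) : w ⊩ K.near X R x Z ε := by
  obtain ⟨y, p, d, q, hp, hd, hq, hy, hxy, hyp, hinf, hqd, hmax⟩ := S.gaugeVal_elim hε H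
  obtain ⟨y', hy', hxy', hlt⟩ := ap_elim hlt
  obtain ⟨p', hp', hyp', hlt⟩ := ap_elim hlt
  have hyy := rel_unique S.map (avail_left_of_mem hx) hy' hy hxy' hxy
  have hpp := rel_unique S.norm hy hp' (avail_left_of_mem hp)
    (rel_congr (eq_refl (avail_of_rel hyp)) hyy (eq_refl hp') hyp') hyp
  have hlt : S.reals.Lt (S.reals.el hp) (S.reals.el hδ) :=
    RealsAt.lt_congr hpp (eq_refl (avail_left_of_mem hδ)) hlt
  -- With q = ε - ρ(x, Z): if 0 < q, a point of Z lies within ρ(x, Z) + q = ε of x; if q < δ, both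
  -- terms of the maximum are below δ, contrary to δ < m.
  rcases (S.reals.pos_iff (ha := hδ) |>.2 hδpos).cotrans (S.reals.el hq) with hpos | hqδ
  · obtain ⟨z, a, ha, hz, hxz, hlt⟩ := exists_dist_lt S.reals S.metric hd hinf hpos
    rw [add_comm, hqd] at hlt
    exact exIn_intro hz (ap₂_intro (avail_left_of_mem ha) hxz hlt)
  · exact (hδm.not_le (S.reals.max_le (hp := hp) (hq := hq) hmax hlt.le hqδ.le)).elim

/-- Any positive δ strictly below the infimum M of the gauge serves for all x at once. The gauge is
built at the world where ε is given, and its description persists to the later worlds where x and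
the bound on ‖f(x)‖ appear. -/
theorem isUniformlyZStable (S : Setting w R X Y f Z) (hpos : w ⊩ K.hasPositivity X R)
    (hst : w ⊩ K.isZStable R X Y f Z) : w ⊩ K.isUniformlyZStable R X Y f Z := by
  refine allIn_intro fun w₁ hw₁ ε hε w₂ hw₂ hεpos => ?_
  have hw₀₂ := hw₁.trans hw₂
  have T := S.mono hw₀₂
  have hε := Up.mono _ hw₂ hε
  obtain ⟨g, hga, hg⟩ := T.exists_gauge hε
  have hgpos : w₂ ⊩ K.allIn X.car fun x => K.ap g x fun u => K.pos R u := by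
    refine allIn_intro fun w₃ hw₃ x hx => ?_
    obtain ⟨m, hm, hxm⟩ := rel_total (Up.mono _ hw₃ hg.1) hx
    have hma := avail_left_of_mem hm
    exact ⟨m, hma, hxm, (T.mono hw₃).gaugeVal_pos (Up.mono _ hw₃ hε) (Up.mono _ hw₃ hεpos) hm
      (allIn_elim (Up.mono _ (hw₀₂.trans hw₃) hst) hx)
      (hg.2 w₃ hw₃ x m (avail_left_of_mem hx) hma hxm).2.2⟩
  obtain ⟨M, hM, hMpos, hinf⟩ := exIn_elim (imp_elim (imp_elim (imp_elim
    (all_elim (Up.mono _ hw₀₂ hpos) hga) hg.1) (T.gauge_uniformlyContinuous hε hg)) hgpos)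
  obtain ⟨δ, hδpos, hδM⟩ := RealsAt.exists_pos_lt (T.reals.pos_iff (ha := hM) |>.2 hMpos)
  obtain ⟨δ, hδ, rfl⟩ := RealsAt.exists_el δ
  refine exIn_intro hδ ⟨hδpos, allIn_intro fun w₃ hw₃ x hx w₄ hw₄ hlt => ?_⟩
  have hw₂₄ := hw₃.trans hw₄
  have U := T.mono hw₂₄
  have hx := Up.mono _ hw₄ hx
  obtain ⟨m, hma, hxm, hMm⟩ := ap_elim (allIn_elim (Up.mono _ hw₂₄ hinf).2.1 hx)
  obtain ⟨-, hm, hval⟩ := hg.2 w₄ hw₂₄ x m (avail_left_of_mem hx) hma hxm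
  have hδM : U.reals.Lt (U.reals.el (Up.mono _ hw₂₄ hδ)) (U.reals.el (Up.mono _ hw₂₄ hM)) :=
    Up.mono _ hw₂₄ hδM
  have hMm : U.reals.el (Up.mono _ hw₂₄ hM) ≤ U.reals.el hm := hMm
  exact U.near_of_gaugeVal (Up.mono _ hw₂₄ hε) hm (Up.mono _ hw₂₄ hδ) (Up.mono _ hw₂₄ hδpos)
    (hδM.trans_le hMm) hx hval hlt

end Setting

end BISH

/-! ### Derivability of the theorem -/

theorem mainTheorem1 :
    BISH.Provable (
      BISH.forReals fun ω R =>
      BISH.allMetric R fun X =>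
      BISH.allNormed R fun Y =>
      BISH.all fun f => BISH.isFun f X.car Y.car ⟹
      BISH.all fun Z => BISH.isZeroSet X Y f Z ⟹
        X.isCompact R ω ⟹
        X.hasPositivity R ⟹
        BISH.isUniformlyContinuous R X Y f ⟹
        BISH.isZStable R X Y f Z ⟹
        (BISH.ex fun z => z ∊ Z) ⟹
        X.isLocated R Z ⟹
        BISH.isUniformlyZStable R X Y f Z) := by
  refine BISH.provable_of_forall_sat fun _ _ _ => ?_
  -- Each quantifier contributes a later world, its inequality, a name and the availability of that
  -- name. Each implication contributes a later world, its inequality and the forced premise. All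
  -- premises used are then moved to the last world `w`.
  refine fun _ _ _ _ _ _ _ _ _ car _ _ _ plus _ _ _ times _ _ _ less _ _ _ zero' _ _ _ one _
    w₁ _ hR _ _ X _ _ _ dist _ w₂ _ hX _ _ Y _ _ _ sum _ _ _ smul _ _ _ o _ _ _ norm _ w₃ _ hY
    _ _ f _ w₄ _ hf _ _ Z _ w₅ _ hZ _ _ _ w₆ _ hpos w₇ _ hfc w₈ _ hst w₉ _ hz w _ hloc => ?_
  have m₁ : w₁ ≤ w := by order
  have m₂ : w₂ ≤ w := by order
  have m₃ : w₃ ≤ w := by order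
  have m₄ : w₄ ≤ w := by order
  have m₅ : w₅ ≤ w := by order
  have m₆ : w₆ ≤ w := by order
  have m₇ : w₇ ≤ w := by order
  have m₈ : w₈ ≤ w := by order
  have m₉ : w₉ ≤ w := by order
  have hR := BISH.Up.mono _ m₁ hR
  have hY := BISH.Up.mono _ m₃ hY
  have hZ : w ⊩ BISH.K.isZeroSet ⟨X, dist⟩ ⟨Y, sum, smul, o, norm⟩ f Z :=
    BISH.Up.mono _ m₅ hZ
  have S : BISH.Setting w ⟨car, plus, times, less, zero', one⟩ ⟨X, dist⟩
      ⟨Y, sum, smul, o, norm⟩ f Z :=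
    { reals := ⟨hR.1, hR.2.1, hR.2.2.2⟩
      metric := BISH.Up.mono _ m₂ hX
      norm := hY.2.2.2.1
      norm_add := hY.2.2.2.2.2.2.2.2.2.2.2.2.2.1
      map := BISH.Up.mono _ m₄ hf
      subset := BISH.allIn_intro fun w' hw z hz =>
        ((BISH.iff_elim (BISH.all_elim (BISH.Up.mono _ hw hZ) (BISH.avail_left_of_mem hz))).1 hz).1
      located := hloc
      cont := BISH.Up.mono _ m₇ hfc
      sum := hY.2.1
      inhabited := BISH.Up.mono _ m₉ hz }
  exact S.isUniformlyZStable (BISH.Up.mono _ m₆ hpos) (BISH.Up.mono _ m₈ hst)
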